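/- Let $N\ge 2$, let $\alpha\in(0,2)$, and let $\Omega\subset\mathbb{R}^N$ be a bounded open set with $0\in\Omega$ (for instance a bounded domain with $C^2$ boundary; no regularity of $\partial\Omega$ is required). Put $w(x)=|x|^\alpha$ and, for each integer $k\ge 1$, $$w_k(x)=\begin{cases}|x|^\alpha, & |x|\ge 1/k,\\ \left(\tfrac34|x|^2+\tfrac1{4k^2}\right)^{\alpha/2}, & |x|\le 1/k.\end{cases}$$ For a weight $\rho$ that is positive almost everywhere, let $L^2(\Omega;\rho)$ be the space of measurable $u$ with $\int_\Omega u^2\rho\,dx<\infty$, let $H^1_\rho(\Omega)$ be the space of all $u\in L^2(\Omega)$ whose distributional gradient $\nabla u$ lies in $L^2(\Omega;\rho)$, with inner product $\int_\Omega uv\rho\,dx+\int_\Omega\nabla u\cdot\nabla v\,\rho\,dx$, and let $H^1_{\rho,0}(\Omega)$ be the closure of $C_0^\infty(\Omega)$ in $H^1_\rho(\Omega)$. A weak solution of $-\mathrm{div}(\rho\nabla u)=f$ in $\Omega$, $u=0$ on $\partial\Omega$, is a function $u\in H^1_{\rho,0}(\Omega)$ with $\int_\Omega(\nabla u\cdot\nabla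 v)\rho\,dx=\int_\Omega fv\,dx$ for all $v\in H^1_{\rho,0}(\Omega)$. Let $f\in L^2(\Omega;w^{-1})$ and, for each $k\ge1$, let $u_k\in H^1_{w_k,0}(\Omega)$ be the weak solution of $-\mathrm{div}(w_k\nabla u_k)=f$ in $\Omega$, $u_k=0$ on $\partial\Omega$. Then every $u_k$ belongs to $H^1_{w,0}(\Omega)$, and there is $u_0\in H^1_{w,0}(\Omega)$ such that $u_k\rightharpoonup u_0$ weakly in $H^1_{w,0}(\Omega)$ and $u_k\to u_0$ strongly in $L^2(\Omega)$. Moreover, $u_0$ is the unique weak solution of $-\mathrm{div}(w\nabla u)=f$ in $\Omega$, $u=0$ on $\partial\Omega$. -/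

import Mathlib

open MeasureTheory Filter Topology

noncomputable section

namespace DegenerateElliptic

/-- The degenerate weight `w(x) = |x|^α`. -/
def weight {N : ℕ} (α : ℝ) (x : EuclideanSpace ℝ (Fin N)) : ℝ := ‖x‖ ^ α

/-- The regularized weight `w_ε`, equal to `|x|^α` for `|x| ≥ ε` and to
`(3/4 |x|² + 1/4 ε²)^(α/2)` for `|x| ≤ ε` (the two formulas agree for `|x| = ε`). -/
def regWeight {N : ℕ} (α ε : ℝ) (x : EuclideanSpace ℝ (Fin N)) : ℝ :=
  if ε ≤ ‖x‖ then ‖x‖ ^ α else (3 / 4 * ‖x‖ ^ 2 + 1 / 4 * ε ^ 2) ^ (α / 2)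

/-- The measure `w dx` on `Ω`, so that `L²(Ω; w)` is `L²` of this measure.
It is used only for weights that are positive almost everywhere. -/
def weightedMeasure {N : ℕ} (Ω : TopologicalSpace.Opens (EuclideanSpace ℝ (Fin N)))
    (w : EuclideanSpace ℝ (Fin N) → ℝ) : Measure (EuclideanSpace ℝ (Fin N)) :=
  (volume.restrict (Ω : Set (EuclideanSpace ℝ (Fin N)))).withDensity
    (fun x => ENNReal.ofReal (w x))

/-- The locally integrable vector field `G` is the distributional gradient of the locally
integrable function `u` on `Ω`: `∫_Ω u ∂ᵢφ dx = - ∫_Ω Gᵢ φ dx` for all test functions `φ`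
and all `i`. -/
structure HasWeakGradient {N : ℕ} (Ω : TopologicalSpace.Opens (EuclideanSpace ℝ (Fin N)))
    (u : EuclideanSpace ℝ (Fin N) → ℝ)
    (G : EuclideanSpace ℝ (Fin N) → EuclideanSpace ℝ (Fin N)) : Prop where
  locInt : LocallyIntegrableOn u (Ω : Set (EuclideanSpace ℝ (Fin N)))
  locInt_grad : LocallyIntegrableOn G (Ω : Set (EuclideanSpace ℝ (Fin N)))
  integral_eq : ∀ (φ : TestFunction Ω ℝ ⊤) (i : Fin N),
    ∫ x in (Ω : Set (EuclideanSpace ℝ (Fin N))),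
        u x * fderiv ℝ φ x (EuclideanSpace.single i 1) =
      - ∫ x in (Ω : Set (EuclideanSpace ℝ (Fin N))), G x i * φ x

lemma integrableOn_mul_of_tsupport {N : ℕ}
    {Ω : TopologicalSpace.Opens (EuclideanSpace ℝ (Fin N))}
    {g : EuclideanSpace ℝ (Fin N) → ℝ}
    (hg : LocallyIntegrableOn g (Ω : Set (EuclideanSpace ℝ (Fin N))))
    {ψ : EuclideanSpace ℝ (Fin N) → ℝ} (hc : Continuous ψ) (hs : HasCompactSupport ψ)
    (ht : tsupport ψ ⊆ Ω) :
    IntegrableOn (fun x => g x * ψ x) (Ω : Set (EuclideanSpace ℝ (Fin N))) := by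
  have h1 : IntegrableOn (fun x => g x * ψ x) (tsupport ψ) :=
    (hg.integrableOn_compact_subset ht hs).mul_continuousOn hc.continuousOn hs
  refine Integrable.integrableOn ?_
  refine (integrableOn_iff_integrable_of_support_subset ?_).1 h1
  intro x hx
  apply subset_tsupport ψ
  intro h0
  exact hx (by simp [h0])

lemma locallyIntegrableOn_coord {N : ℕ}
    {Ω : TopologicalSpace.Opens (EuclideanSpace ℝ (Fin N))}
    {G : EuclideanSpace ℝ (Fin N) → EuclideanSpace ℝ (Fin N)}
    (hG : LocallyIntegrableOn G (Ω : Set (EuclideanSpace ℝ (Fin N)))) (i : Fin N) :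
    LocallyIntegrableOn (fun x => G x i) (Ω : Set (EuclideanSpace ℝ (Fin N))) := by
  intro x hx
  obtain ⟨s, hs, h⟩ := hG x hx
  exact ⟨s, hs, (EuclideanSpace.proj (𝕜 := ℝ) i).integrable_comp h⟩

lemma integrableOn_mul_fderiv_test {N : ℕ}
    {Ω : TopologicalSpace.Opens (EuclideanSpace ℝ (Fin N))}
    {u : EuclideanSpace ℝ (Fin N) → ℝ}
    (hu : LocallyIntegrableOn u (Ω : Set (EuclideanSpace ℝ (Fin N))))
    (φ : TestFunction Ω ℝ ⊤) (v : EuclideanSpace ℝ (Fin N)) :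
    IntegrableOn (fun x => u x * fderiv ℝ φ x v) (Ω : Set (EuclideanSpace ℝ (Fin N))) :=
  integrableOn_mul_of_tsupport hu
    (((TestFunctionClass.map_contDiff φ).continuous_fderiv (by simp)).clm_apply
      continuous_const)
    ((TestFunctionClass.map_hasCompactSupport φ).fderiv_apply ℝ v)
    ((tsupport_fderiv_apply_subset ℝ v).trans (TestFunctionClass.tsupport_map_subset φ))

lemma integrableOn_mul_test {N : ℕ}
    {Ω : TopologicalSpace.Opens (EuclideanSpace ℝ (Fin N))}
    {u : EuclideanSpace ℝ (Fin N) → ℝ}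
    (hu : LocallyIntegrableOn u (Ω : Set (EuclideanSpace ℝ (Fin N))))
    (φ : TestFunction Ω ℝ ⊤) :
    IntegrableOn (fun x => u x * φ x) (Ω : Set (EuclideanSpace ℝ (Fin N))) :=
  integrableOn_mul_of_tsupport hu (TestFunctionClass.map_contDiff φ).continuous
    (TestFunctionClass.map_hasCompactSupport φ) (TestFunctionClass.tsupport_map_subset φ)

lemma HasWeakGradient.zero {N : ℕ} (Ω : TopologicalSpace.Opens (EuclideanSpace ℝ (Fin N))) :
    HasWeakGradient Ω (fun _ => 0) (fun _ => 0) where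
  locInt := locallyIntegrableOn_zero
  locInt_grad := locallyIntegrableOn_zero
  integral_eq := by simp

lemma HasWeakGradient.add {N : ℕ} {Ω : TopologicalSpace.Opens (EuclideanSpace ℝ (Fin N))}
    {u v : EuclideanSpace ℝ (Fin N) → ℝ}
    {G H : EuclideanSpace ℝ (Fin N) → EuclideanSpace ℝ (Fin N)}
    (hu : HasWeakGradient Ω u G) (hv : HasWeakGradient Ω v H) :
    HasWeakGradient Ω (u + v) (G + H) where
  locInt := hu.locInt.add hv.locInt
  locInt_grad := hu.locInt_grad.add hv.locInt_grad
  integral_eq φ i := by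
    simp only [Pi.add_apply, PiLp.add_apply, add_mul]
    rw [integral_add (integrableOn_mul_fderiv_test hu.locInt φ _)
        (integrableOn_mul_fderiv_test hv.locInt φ _),
      integral_add (integrableOn_mul_test (locallyIntegrableOn_coord hu.locInt_grad i) φ)
        (integrableOn_mul_test (locallyIntegrableOn_coord hv.locInt_grad i) φ),
      hu.integral_eq, hv.integral_eq, neg_add]

lemma HasWeakGradient.smul {N : ℕ} {Ω : TopologicalSpace.Opens (EuclideanSpace ℝ (Fin N))}
    {u : EuclideanSpace ℝ (Fin N) → ℝ}
    {G : EuclideanSpace ℝ (Fin N) → EuclideanSpace ℝ (Fin N)}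
    (hu : HasWeakGradient Ω u G) (c : ℝ) :
    HasWeakGradient Ω (c • u) (c • G) where
  locInt := hu.locInt.smul c
  locInt_grad := hu.locInt_grad.smul c
  integral_eq φ i := by
    simp only [Pi.smul_apply, PiLp.smul_apply, smul_eq_mul, mul_assoc]
    rw [integral_const_mul, integral_const_mul, hu.integral_eq, mul_neg]

/-- The Hilbert space `L²(Ω; w) × L²(Ω; w)^N`, with
`‖(u, G)‖² = ∫_Ω u² w dx + ∫_Ω |G|² w dx`. -/
abbrev PairSpace {N : ℕ} (Ω : TopologicalSpace.Opens (EuclideanSpace ℝ (Fin N)))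
    (w : EuclideanSpace ℝ (Fin N) → ℝ) : Type :=
  WithLp 2 (Lp ℝ 2 (weightedMeasure Ω w) ×
    Lp (EuclideanSpace ℝ (Fin N)) 2 (weightedMeasure Ω w))

/-- The weighted Sobolev space `H¹_w(Ω)` of all `u ∈ L²(Ω)` (unweighted) whose distributional
gradient lies in `L²(Ω; w)`. Such a `u` is represented by the pair `(u, ∇u)`, so that the
inner product inherited from `PairSpace` is `∫_Ω u v w dx + ∫_Ω ∇u · ∇v w dx`. -/
def H1 {N : ℕ} (Ω : TopologicalSpace.Opens (EuclideanSpace ℝ (Fin N)))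
    (w : EuclideanSpace ℝ (Fin N) → ℝ) : Submodule ℝ (PairSpace Ω w) where
  carrier := {U | ∃ (u : EuclideanSpace ℝ (Fin N) → ℝ)
    (G : EuclideanSpace ℝ (Fin N) → EuclideanSpace ℝ (Fin N)),
    MemLp u 2 (volume.restrict (Ω : Set (EuclideanSpace ℝ (Fin N)))) ∧
    HasWeakGradient Ω u G ∧
    U.fst =ᵐ[weightedMeasure Ω w] u ∧ U.snd =ᵐ[weightedMeasure Ω w] G}
  zero_mem' := ⟨fun _ => 0, fun _ => 0, MemLp.zero', HasWeakGradient.zero Ω,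
    Lp.coeFn_zero _ _ _, Lp.coeFn_zero _ _ _⟩
  add_mem' := by
    rintro U V ⟨u, G, hu, hG, hU1, hU2⟩ ⟨v, H, hv, hH, hV1, hV2⟩
    exact ⟨u + v, G + H, hu.add hv, hG.add hH,
      (Lp.coeFn_add U.fst V.fst).trans (hU1.add hV1),
      (Lp.coeFn_add U.snd V.snd).trans (hU2.add hV2)⟩
  smul_mem' := by
    rintro c U ⟨u, G, hu, hG, hU1, hU2⟩
    exact ⟨c • u, c • G, hu.const_smul c, hG.smul c,
      (Lp.coeFn_smul c U.fst).trans (hU1.const_smul c),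
      (Lp.coeFn_smul c U.snd).trans (hU2.const_smul c)⟩

/-- The test functions `𝒟(Ω) = C₀^∞(Ω)` as a subspace of `H¹_w(Ω)`. -/
def testSubspace {N : ℕ} (Ω : TopologicalSpace.Opens (EuclideanSpace ℝ (Fin N)))
    (w : EuclideanSpace ℝ (Fin N) → ℝ) : Submodule ℝ (H1 Ω w) where
  carrier := {U | ∃ φ : TestFunction Ω ℝ ⊤, U.1.fst =ᵐ[weightedMeasure Ω w] φ}
  zero_mem' := ⟨0, Lp.coeFn_zero _ _ _⟩
  add_mem' := by
    rintro U V ⟨φ, hφ⟩ ⟨ψ, hψ⟩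
    exact ⟨φ + ψ, (Lp.coeFn_add U.1.fst V.1.fst).trans (hφ.add hψ)⟩
  smul_mem' := by
    rintro c U ⟨φ, hφ⟩
    exact ⟨c • φ, (Lp.coeFn_smul c U.1.fst).trans (hφ.const_smul c)⟩

/-- `H¹_{w,0}(Ω)`, the closure of `𝒟(Ω)` in `H¹_w(Ω)` for the norm of `H¹_w(Ω)`. -/
def H10 {N : ℕ} (Ω : TopologicalSpace.Opens (EuclideanSpace ℝ (Fin N)))
    (w : EuclideanSpace ℝ (Fin N) → ℝ) : Submodule ℝ (H1 Ω w) :=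
  (testSubspace Ω w).topologicalClosure

/-- The function underlying an element of `H¹_{w,0}(Ω)` (defined almost everywhere on `Ω`). -/
def fn {N : ℕ} {Ω : TopologicalSpace.Opens (EuclideanSpace ℝ (Fin N))}
    {w : EuclideanSpace ℝ (Fin N) → ℝ} (u : H10 Ω w) : EuclideanSpace ℝ (Fin N) → ℝ :=
  u.1.1.fst

/-- The distributional gradient of an element of `H¹_{w,0}(Ω)`. -/
def grad {N : ℕ} {Ω : TopologicalSpace.Opens (EuclideanSpace ℝ (Fin N))}
    {w : EuclideanSpace ℝ (Fin N) → ℝ} (u : H10 Ω w) :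
    EuclideanSpace ℝ (Fin N) → EuclideanSpace ℝ (Fin N) :=
  u.1.1.snd

/-- `u ∈ H¹_{w,0}(Ω)` is a weak solution of `-div(w ∇u) = f` in `Ω`, `u = 0` on `∂Ω`:
`∫_Ω (∇u · ∇v) w dx = ∫_Ω f v dx` for all `v ∈ H¹_{w,0}(Ω)`. -/
def IsWeakSolution {N : ℕ} {Ω : TopologicalSpace.Opens (EuclideanSpace ℝ (Fin N))}
    {w : EuclideanSpace ℝ (Fin N) → ℝ} (f : EuclideanSpace ℝ (Fin N) → ℝ)
    (u : H10 Ω w) : Prop :=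
  ∀ v : H10 Ω w,
    ∫ x in (Ω : Set (EuclideanSpace ℝ (Fin N))), inner ℝ (grad u x) (grad v x) * w x =
      ∫ x in (Ω : Set (EuclideanSpace ℝ (Fin N))), f x * fn v x

/-- Weak convergence in the Hilbert space `H¹_{w,0}(Ω)`. -/
def WeaklyConverges {N : ℕ} {Ω : TopologicalSpace.Opens (EuclideanSpace ℝ (Fin N))}
    {w : EuclideanSpace ℝ (Fin N) → ℝ} (v : ℕ → H10 Ω w) (u : H10 Ω w) : Prop :=
  ∀ ℓ : H10 Ω w →L[ℝ] ℝ, Tendsto (fun k => ℓ (v k)) atTop (𝓝 (ℓ u))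

end DegenerateElliptic

end

open MeasureTheory Filter Topology

noncomputable section

namespace DegenerateElliptic

/-! Everything rests on a Poincaré inequality that controls the unweighted norm of `u` by the
weighted norm of its gradient. Integrating `φ²` by parts against `x_i` and absorbing gives `∫ φ² ≤ 4
∫ |x|² |∇φ|²`, and `|x|² ≤ R^(2-α) |x|^α` on a set inside the ball of radius `R` (`poincare_test`).
The constant depends on the weight only through the lower bound `|x|^α ≤ w`.

Since `α < N`, `1/w` is integrable, so `L²(Ω; w)` embeds in `L¹(Ω)` and weak gradients survive
limits. With the Poincaré inequality this identifies `H10` with a closed set of pairs `(u, ∇u)` in a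
Hilbert space (`mem_H10_iff`), and Lax-Milgram solves the limit problem.

Convergence needs no compactness. Let `w ≤ w_k`, with `u_k` and `u₀` the solutions for `w_k` and
`w`. Minimality of `u_k` for the `w_k`-energy gives, for every test function `φ`, `‖∇(u_k - u₀)‖²_w
≤ ‖∇(φ - u₀)‖²_w + ∫ (w_k - w) |∇φ|²` (`IsWeakSolution.norm_sq_gradL_sub_le`). The first term is
small by density; the second is at most `k^(-α) ∫ |∇φ|²`. So `u_k → u₀` strongly in the energy norm,
which implies both the weak convergence and, by Poincaré, the `L²(Ω)` convergence. -/

variable {N : ℕ} {α M M' : ℝ} {Ω : TopologicalSpace.Opens (EuclideanSpace ℝ (Fin N))}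
  {w w' : EuclideanSpace ℝ (Fin N) → ℝ}

/-! ### Admissible weights and the comparison of `w_ε` with `|x|^α` -/

/-- A measurable weight that dominates `|x|^α` and is bounded by `M` on `Ω`. -/
structure IsAdmissible (Ω : TopologicalSpace.Opens (EuclideanSpace ℝ (Fin N))) (α M : ℝ)
    (w : EuclideanSpace ℝ (Fin N) → ℝ) : Prop where
  measurable : Measurable w
  weight_le : ∀ x, weight α x ≤ w x
  le_bound : ∀ x ∈ Ω, w x ≤ M

lemma weight_nonneg (α : ℝ) (x : EuclideanSpace ℝ (Fin N)) : 0 ≤ weight α x :=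
  Real.rpow_nonneg (norm_nonneg x) α

lemma weight_pos (α : ℝ) {x : EuclideanSpace ℝ (Fin N)} (hx : x ≠ 0) : 0 < weight α x :=
  Real.rpow_pos_of_pos (norm_pos_iff.2 hx) α

lemma measurable_weight (α : ℝ) :
    Measurable (weight α : EuclideanSpace ℝ (Fin N) → ℝ) := by
  unfold weight
  fun_prop

lemma measurable_regWeight (α ε : ℝ) :
    Measurable (regWeight α ε : EuclideanSpace ℝ (Fin N) → ℝ) := by
  unfold regWeight
  exact Measurable.ite (measurableSet_le measurable_const measurable_norm) (by fun_prop)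
    (by fun_prop)

/-- For `|x| < ε` the base `3/4 |x|² + 1/4 ε²` is a convex combination of `|x|²` and `ε²`, so it
lies between them; the power `α/2` is monotone. The upper bound below comes from the same remark. -/
lemma weight_le_regWeight (hα : 0 ≤ α) {ε : ℝ} (hε : 0 ≤ ε) (x : EuclideanSpace ℝ (Fin N)) :
    weight α x ≤ regWeight α ε x := by
  unfold weight regWeight
  split_ifs with h
  · exact le_rfl
  · have h1 : ‖x‖ ^ α = (‖x‖ ^ 2) ^ (α / 2) := by
      rw [← Real.rpow_natCast, ← Real.rpow_mul (norm_nonneg x)]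
      congr 1
      push_cast
      ring
    rw [h1]
    refine Real.rpow_le_rpow (by positivity) ?_ (by positivity)
    nlinarith [norm_nonneg x]

lemma regWeight_le (hα : 0 ≤ α) {ε : ℝ} (hε : 0 ≤ ε) (x : EuclideanSpace ℝ (Fin N)) :
    regWeight α ε x ≤ weight α x + ε ^ α := by
  have hε' := Real.rpow_nonneg hε α
  unfold weight regWeight
  split_ifs with h
  · linarith
  · have h1 : ε ^ α = (ε ^ 2) ^ (α / 2) := by
      rw [← Real.rpow_natCast, ← Real.rpow_mul hε]
      congr 1
      push_cast
      ring
    have h2 : (3 / 4 * ‖x‖ ^ 2 + 1 / 4 * ε ^ 2) ^ (α / 2) ≤ (ε ^ 2) ^ (α / 2) := by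
      refine Real.rpow_le_rpow (by positivity) ?_ (by positivity)
      nlinarith [norm_nonneg x]
    have := Real.rpow_nonneg (norm_nonneg x) α
    linarith

lemma isAdmissible_weight (hα : 0 ≤ α) {R : ℝ} (hR : ∀ x ∈ Ω, ‖x‖ ≤ R) :
    IsAdmissible Ω α (R ^ α) (weight α) where
  measurable := measurable_weight α
  weight_le _ := le_rfl
  le_bound x hx := Real.rpow_le_rpow (norm_nonneg x) (hR x hx) hα

lemma isAdmissible_regWeight (hα : 0 ≤ α) {R ε : ℝ} (hε : 0 ≤ ε) (hR : ∀ x ∈ Ω, ‖x‖ ≤ R) :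
    IsAdmissible Ω α (R ^ α + ε ^ α) (regWeight α ε) where
  measurable := measurable_regWeight α ε
  weight_le := weight_le_regWeight hα hε
  le_bound x hx := (regWeight_le hα hε x).trans
    (add_le_add_left ((isAdmissible_weight hα hR).le_bound x hx) _)

namespace IsAdmissible

lemma nonneg (hw : IsAdmissible Ω α M w) (x : EuclideanSpace ℝ (Fin N)) : 0 ≤ w x :=
  (weight_nonneg α x).trans (hw.weight_le x)

lemma pos (hw : IsAdmissible Ω α M w) {x : EuclideanSpace ℝ (Fin N)} (hx : x ≠ 0) : 0 < w x :=
  (weight_pos α hx).trans_le (hw.weight_le x)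

lemma ae_pos (hN : 0 < N) (hw : IsAdmissible Ω α M w) :
    ∀ᵐ x ∂(volume.restrict (Ω : Set (EuclideanSpace ℝ (Fin N)))), 0 < w x := by
  have : Nonempty (Fin N) := ⟨⟨0, hN⟩⟩
  have : Nontrivial (EuclideanSpace ℝ (Fin N)) := inferInstance
  refine ae_restrict_of_ae ?_
  filter_upwards [compl_mem_ae_iff.2 (measure_singleton (0 : EuclideanSpace ℝ (Fin N)))] with x hx
  exact hw.pos hx

end IsAdmissible

/-! ### Weighted measures and the duality of `L²(Ω; w)` with `L²(Ω; w⁻¹)` -/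

lemma weightedMeasure_absolutelyContinuous
    (Ω : TopologicalSpace.Opens (EuclideanSpace ℝ (Fin N)))
    (w : EuclideanSpace ℝ (Fin N) → ℝ) :
    weightedMeasure Ω w ≪ volume.restrict (Ω : Set (EuclideanSpace ℝ (Fin N))) :=
  withDensity_absolutelyContinuous _ _

lemma absolutelyContinuous_weightedMeasure (hm : Measurable w)
    (hpos : ∀ᵐ x ∂(volume.restrict (Ω : Set (EuclideanSpace ℝ (Fin N)))), 0 < w x) :
    volume.restrict (Ω : Set (EuclideanSpace ℝ (Fin N))) ≪ weightedMeasure Ω w :=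
  withDensity_absolutelyContinuous' hm.ennreal_ofReal.aemeasurable
    (hpos.mono fun x hx => by simpa using hx)

lemma integrable_weightedMeasure_iff {F : Type*} [NormedAddCommGroup F] [NormedSpace ℝ F]
    (hm : Measurable w) (h0 : ∀ x, 0 ≤ w x) {g : EuclideanSpace ℝ (Fin N) → F} :
    Integrable g (weightedMeasure Ω w) ↔
      IntegrableOn (fun x => w x • g x) (Ω : Set (EuclideanSpace ℝ (Fin N))) := by
  unfold weightedMeasure
  rw [integrable_withDensity_iff_integrable_smul' hm.ennreal_ofReal (by simp)]
  simp_rw [ENNReal.toReal_ofReal (h0 _)]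
  rfl

lemma integral_weightedMeasure {F : Type*} [NormedAddCommGroup F] [NormedSpace ℝ F]
    (hm : Measurable w) (h0 : ∀ x, 0 ≤ w x) (g : EuclideanSpace ℝ (Fin N) → F) :
    ∫ x, g x ∂(weightedMeasure Ω w) =
      ∫ x in (Ω : Set (EuclideanSpace ℝ (Fin N))), w x • g x := by
  unfold weightedMeasure
  rw [integral_withDensity_eq_integral_toReal_smul hm.ennreal_ofReal (by simp)]
  simp_rw [ENNReal.toReal_ofReal (h0 _)]

lemma weightedMeasure_mono {w' : EuclideanSpace ℝ (Fin N) → ℝ} (h : ∀ x, w x ≤ w' x) :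
    weightedMeasure Ω w ≤ weightedMeasure Ω w' :=
  withDensity_mono (ae_of_all _ fun x => ENNReal.ofReal_le_ofReal (h x))

/-- If `f ∈ L²(Ω; w⁻¹)` then `f / w ∈ L²(Ω; w)`. -/
lemma memLp_div_weight (hN : 0 < N) (hw : IsAdmissible Ω α M w)
    {f : EuclideanSpace ℝ (Fin N) → ℝ}
    (hf : MemLp f 2 (weightedMeasure Ω fun x => (w x)⁻¹)) :
    MemLp (fun x => f x / w x) 2 (weightedMeasure Ω w) := by
  have hm : Measurable fun x => (w x)⁻¹ := hw.measurable.inv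
  have hfm : AEStronglyMeasurable f (weightedMeasure Ω w) :=
    hf.1.mono_ac ((weightedMeasure_absolutelyContinuous Ω w).trans
      (absolutelyContinuous_weightedMeasure hm
        ((hw.ae_pos hN).mono fun x hx => inv_pos.2 hx)))
  have hdm : AEStronglyMeasurable (fun x => f x / w x) (weightedMeasure Ω w) :=
    (hfm.aemeasurable.div hw.measurable.aemeasurable).aestronglyMeasurable
  rw [memLp_two_iff_integrable_sq hdm, integrable_weightedMeasure_iff hw.measurable hw.nonneg]
  rw [memLp_two_iff_integrable_sq hf.1,
    integrable_weightedMeasure_iff hm fun x => inv_nonneg.2 (hw.nonneg x)] at hf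
  refine hf.congr_fun_ae (ae_of_all _ fun x => ?_)
  rcases eq_or_ne (w x) 0 with h | h
  · simp [h]
  · simp only [smul_eq_mul]
    field_simp

lemma integrableOn_mul_of_memLp (hN : 0 < N) (hw : IsAdmissible Ω α M w)
    {f v : EuclideanSpace ℝ (Fin N) → ℝ}
    (hf : MemLp f 2 (weightedMeasure Ω fun x => (w x)⁻¹))
    (hv : MemLp v 2 (weightedMeasure Ω w)) :
    IntegrableOn (fun x => f x * v x) (Ω : Set (EuclideanSpace ℝ (Fin N))) := by
  have h := (memLp_div_weight hN hw hf).integrable_mul hv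
  rw [integrable_weightedMeasure_iff hw.measurable hw.nonneg] at h
  refine h.congr_fun_ae ?_
  filter_upwards [hw.ae_pos hN] with x hx
  simp only [smul_eq_mul, Pi.mul_apply]
  field_simp

/-- Since `f v = (f/w) v w`, the load is the inner product with `f/w` in `L²(Ω; w)`, hence a
continuous functional. -/
lemma integral_mul_eq_inner (hN : 0 < N) (hw : IsAdmissible Ω α M w)
    {f : EuclideanSpace ℝ (Fin N) → ℝ}
    (hf : MemLp f 2 (weightedMeasure Ω fun x => (w x)⁻¹))
    (v : Lp ℝ 2 (weightedMeasure Ω w)) :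
    ∫ x in (Ω : Set (EuclideanSpace ℝ (Fin N))), f x * v x =
      inner ℝ ((memLp_div_weight hN hw hf).toLp) v := by
  rw [L2.inner_def]
  have h1 : ∫ x, inner ℝ ((memLp_div_weight hN hw hf).toLp _ x) (v x) ∂(weightedMeasure Ω w)
      = ∫ x, (f x / w x) * v x ∂(weightedMeasure Ω w) := by
    refine integral_congr_ae ?_
    filter_upwards [(memLp_div_weight hN hw hf).coeFn_toLp] with x hx
    rw [hx]
    simp [mul_comm]
  rw [h1, integral_weightedMeasure hw.measurable hw.nonneg]
  refine integral_congr_ae ?_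
  filter_upwards [hw.ae_pos hN] with x hx
  simp only [smul_eq_mul]
  field_simp

/-- In polar coordinates the integrand is `r^(N-1-α)`, integrable at `0` because `α < N`. -/
lemma integrableOn_weight_inv (hN : 0 < N) (hα : α < N)
    (hΩ : Bornology.IsBounded (Ω : Set (EuclideanSpace ℝ (Fin N)))) :
    IntegrableOn (fun x => (weight α x)⁻¹) (Ω : Set (EuclideanSpace ℝ (Fin N))) := by
  have : Nonempty (Fin N) := ⟨⟨0, hN⟩⟩
  obtain ⟨R, hR0, hR⟩ := hΩ.exists_pos_norm_le
  have key : Integrable (fun x : EuclideanSpace ℝ (Fin N) =>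
      (Set.indicator (Set.Iic R) (fun r : ℝ => (r ^ α)⁻¹)) ‖x‖) := by
    rw [integrable_fun_norm_addHaar]
    have h1 : IntegrableOn (fun r : ℝ => r ^ ((N : ℝ) - 1 - α)) (Set.Ioc 0 R) := by
      rw [← intervalIntegrable_iff_integrableOn_Ioc_of_le hR0.le]
      exact intervalIntegral.intervalIntegrable_rpow' (by linarith)
    have h2 : IntegrableOn (Set.indicator (Set.Iic R) fun r : ℝ => r ^ ((N : ℝ) - 1 - α))
        (Set.Ioi 0) := by
      rw [IntegrableOn, integrable_indicator_iff measurableSet_Iic, IntegrableOn,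
        Measure.restrict_restrict measurableSet_Iic]
      rwa [Set.inter_comm, Set.Ioi_inter_Iic]
    refine h2.congr_fun ?_ measurableSet_Ioi
    intro r hr
    have hr : 0 < r := hr
    by_cases hrR : r ∈ Set.Iic R
    · simp only [Set.indicator_of_mem hrR, finrank_euclideanSpace, Fintype.card_fin, smul_eq_mul]
      rw [Real.rpow_sub hr, div_eq_mul_inv, ← Real.rpow_natCast, Nat.cast_sub hN, Nat.cast_one]
    · simp [Set.indicator_of_notMem hrR]
  refine (key.integrableOn (s := (Ω : Set (EuclideanSpace ℝ (Fin N))))).congr_fun ?_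
    Ω.isOpen.measurableSet
  intro x hx
  have : ‖x‖ ∈ Set.Iic R := hR x hx
  simp [Set.indicator_of_mem this, weight]

lemma isFiniteMeasure_weightedMeasure_inv (hN : 0 < N) (hα : α < N)
    (hΩ : Bornology.IsBounded (Ω : Set (EuclideanSpace ℝ (Fin N))))
    (hw : IsAdmissible Ω α M w) :
    IsFiniteMeasure (weightedMeasure Ω fun x => (w x)⁻¹) := by
  refine isFiniteMeasure_withDensity_ofReal (Integrable.mono
    (integrableOn_weight_inv hN hα hΩ) hw.measurable.inv.aestronglyMeasurable ?_).2
  have : Nonempty (Fin N) := ⟨⟨0, hN⟩⟩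
  refine ae_restrict_of_ae ?_
  filter_upwards [compl_mem_ae_iff.2 (measure_singleton (0 : EuclideanSpace ℝ (Fin N)))] with x hx
  change ‖(w x)⁻¹‖ ≤ _
  rw [Real.norm_of_nonneg (inv_nonneg.2 (hw.nonneg x)),
    Real.norm_of_nonneg (inv_nonneg.2 (weight_nonneg α x))]
  exact inv_anti₀ (weight_pos α hx) (hw.weight_le x)

lemma isFiniteMeasure_weightedMeasure
    (hΩ : Bornology.IsBounded (Ω : Set (EuclideanSpace ℝ (Fin N))))
    (hw : IsAdmissible Ω α M w) :
    IsFiniteMeasure (weightedMeasure Ω w) := by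
  have : IsFiniteMeasure (volume.restrict (Ω : Set (EuclideanSpace ℝ (Fin N)))) :=
    ⟨by simpa using hΩ.measure_lt_top⟩
  refine isFiniteMeasure_withDensity_ofReal (Integrable.of_bound
    hw.measurable.aestronglyMeasurable M ?_).2
  filter_upwards [ae_restrict_mem Ω.isOpen.measurableSet] with x hx
  rw [Real.norm_of_nonneg (hw.nonneg x)]
  exact hw.le_bound x hx

/-- Cauchy-Schwarz: `∫ |G| ≤ (∫ 1/w)^(1/2) (∫ |G|² w)^(1/2)`. This makes elements of `L²(Ω; w)`
distributions on `Ω`. -/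
lemma integrableOn_of_memLp_weighted (hN : 0 < N) (hα : α < N)
    (hΩ : Bornology.IsBounded (Ω : Set (EuclideanSpace ℝ (Fin N))))
    (hw : IsAdmissible Ω α M w) {F : Type*} [NormedAddCommGroup F]
    {G : EuclideanSpace ℝ (Fin N) → F} (hG : MemLp G 2 (weightedMeasure Ω w)) :
    IntegrableOn G (Ω : Set (EuclideanSpace ℝ (Fin N))) := by
  have := isFiniteMeasure_weightedMeasure_inv hN hα hΩ hw
  have h := integrableOn_mul_of_memLp hN hw (memLp_const (1 : ℝ)) hG.norm
  simp only [one_mul] at h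
  exact (integrable_norm_iff (hG.1.mono_ac
    (absolutelyContinuous_weightedMeasure hw.measurable (hw.ae_pos hN)))).1 h

/-! ### Gradients of test functions and uniqueness of weak gradients -/

lemma gradient_apply_coord (φ : EuclideanSpace ℝ (Fin N) → ℝ) (x : EuclideanSpace ℝ (Fin N))
    (i : Fin N) : gradient φ x i = fderiv ℝ φ x (EuclideanSpace.single i 1) := by
  rw [← toDual_gradient (𝕜 := ℝ), InnerProductSpace.toDual_apply_apply]
  rw [EuclideanSpace.inner_single_right]
  simp

lemma continuous_gradient_test (φ : TestFunction Ω ℝ ⊤) : Continuous (gradient φ) :=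
  (InnerProductSpace.toDual ℝ (EuclideanSpace ℝ (Fin N))).symm.continuous.comp
    (φ.contDiff.continuous_fderiv (by simp))

lemma hasCompactSupport_gradient_test (φ : TestFunction Ω ℝ ⊤) :
    HasCompactSupport (gradient φ) :=
  (φ.hasCompactSupport.fderiv ℝ).comp_left (map_zero _)

lemma gradient_test_eq_zero (φ : TestFunction Ω ℝ ⊤) {x : EuclideanSpace ℝ (Fin N)}
    (hx : x ∉ Ω) : gradient φ x = 0 := by
  have h : fderiv ℝ φ x = 0 := image_eq_zero_of_notMem_tsupport fun h =>
    hx (φ.tsupport_subset (tsupport_fderiv_subset ℝ h))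
  rw [gradient, h, map_zero]

lemma test_eq_zero (φ : TestFunction Ω ℝ ⊤) {x : EuclideanSpace ℝ (Fin N)}
    (hx : x ∉ Ω) : φ x = 0 :=
  image_eq_zero_of_notMem_tsupport fun h => hx (φ.tsupport_subset h)

/-- The distributional gradient of a test function is its classical gradient. -/
lemma hasWeakGradient_test (φ : TestFunction Ω ℝ ⊤) : HasWeakGradient Ω φ (gradient φ) where
  locInt := φ.continuous.locallyIntegrable.locallyIntegrableOn _
  locInt_grad := (continuous_gradient_test φ).locallyIntegrable.locallyIntegrableOn _
  integral_eq ψ i := by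
    simp_rw [gradient_apply_coord]
    have hφ' : Continuous fun x => fderiv ℝ φ x (EuclideanSpace.single i 1) :=
      (φ.contDiff.continuous_fderiv (by simp)).clm_apply continuous_const
    have hψ' : Continuous fun x => fderiv ℝ ψ x (EuclideanSpace.single i 1) :=
      (ψ.contDiff.continuous_fderiv (by simp)).clm_apply continuous_const
    rw [setIntegral_eq_integral_of_forall_compl_eq_zero,
      setIntegral_eq_integral_of_forall_compl_eq_zero]
    · exact integral_mul_fderiv_eq_neg_fderiv_mul_of_integrable
        ((hφ'.mul ψ.continuous).integrable_of_hasCompactSupport ψ.hasCompactSupport.mul_left)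
        ((φ.continuous.mul hψ').integrable_of_hasCompactSupport φ.hasCompactSupport.mul_right)
        ((φ.continuous.mul ψ.continuous).integrable_of_hasCompactSupport
          φ.hasCompactSupport.mul_right)
        (fun x _ => φ.contDiff.differentiable (by simp) x)
        (fun x _ => ψ.contDiff.differentiable (by simp) x)
    · intro x hx
      rw [test_eq_zero ψ hx, mul_zero]
    · intro x hx
      rw [test_eq_zero φ hx, zero_mul]

lemma HasWeakGradient.ae_unique {u v : EuclideanSpace ℝ (Fin N) → ℝ}
    {G H : EuclideanSpace ℝ (Fin N) → EuclideanSpace ℝ (Fin N)}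
    (hu : HasWeakGradient Ω u G) (hv : HasWeakGradient Ω v H)
    (huv : u =ᵐ[volume.restrict (Ω : Set (EuclideanSpace ℝ (Fin N)))] v) :
    G =ᵐ[volume.restrict (Ω : Set (EuclideanSpace ℝ (Fin N)))] H := by
  have key : ∀ i : Fin N, ∀ᵐ x ∂(volume : Measure (EuclideanSpace ℝ (Fin N))),
      x ∈ (Ω : Set (EuclideanSpace ℝ (Fin N))) → G x i - H x i = 0 := by
    intro i
    have hG := locallyIntegrableOn_coord hu.locInt_grad i
    have hH := locallyIntegrableOn_coord hv.locInt_grad i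
    refine Ω.isOpen.ae_eq_zero_of_integral_contDiff_smul_eq_zero (hG.sub hH) ?_
    intro g hg hgc hgs
    let φ : TestFunction Ω ℝ ⊤ := ⟨g, hg, hgc, hgs⟩
    have h1 := hu.integral_eq φ i
    have h2 := hv.integral_eq φ i
    have h3 : ∫ x in (Ω : Set (EuclideanSpace ℝ (Fin N))),
        u x * fderiv ℝ φ x (EuclideanSpace.single i 1) =
        ∫ x in (Ω : Set (EuclideanSpace ℝ (Fin N))),
        v x * fderiv ℝ φ x (EuclideanSpace.single i 1) := by
      refine integral_congr_ae ?_
      filter_upwards [huv] with x hx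
      rw [hx]
    have h4 := integral_sub (integrableOn_mul_test hG φ) (integrableOn_mul_test hH φ)
    have h5 : ∫ x, g x • (((fun x => G x i) - fun x => H x i) x) =
        ∫ x in (Ω : Set (EuclideanSpace ℝ (Fin N))), (G x i * φ x - H x i * φ x) := by
      rw [setIntegral_eq_integral_of_forall_compl_eq_zero]
      · refine integral_congr_ae (ae_of_all _ fun x => ?_)
        change g x * (G x i - H x i) = G x i * g x - H x i * g x
        ring
      · intro x hx
        have h0 : g x = 0 := test_eq_zero φ hx
        change G x i * g x - H x i * g x = 0
        simp [h0]
    exact h5.trans (h4.trans (by linarith))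
  filter_upwards [(ae_restrict_iff' Ω.isOpen.measurableSet).2 (ae_all_iff.2 key |>.mono
    fun x hx hxΩ i => hx i hxΩ)] with x hx
  ext i
  exact sub_eq_zero.1 (hx i)

/-! ### The weighted Poincaré inequality -/

/-- Integration by parts of `φ²` against `x_i`, using `∂_i x_i = 1`. -/
lemma integral_sq_test (φ : TestFunction Ω ℝ ⊤) (i : Fin N) :
    ∫ x, φ x ^ 2 =
      - ∫ x, 2 * φ x * fderiv ℝ φ x (EuclideanSpace.single i 1) * x i := by
  have hd : ∀ x, DifferentiableAt ℝ φ x := fun x => φ.contDiff.differentiable (by simp) x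
  have hφ' : Continuous fun x => fderiv ℝ φ x (EuclideanSpace.single i 1) :=
    (φ.contDiff.continuous_fderiv (by simp)).clm_apply continuous_const
  have hφc := φ.continuous
  have hpc : Continuous fun x : EuclideanSpace ℝ (Fin N) => x i := by fun_prop
  have hpd : ∀ x, fderiv ℝ (fun x : EuclideanSpace ℝ (Fin N) => x i) x
      (EuclideanSpace.single i 1) = 1 := by
    intro x
    have : (fun x : EuclideanSpace ℝ (Fin N) => x i) =
        (EuclideanSpace.proj (𝕜 := ℝ) i : EuclideanSpace ℝ (Fin N) →L[ℝ] ℝ) := rfl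
    rw [this, ContinuousLinearMap.fderiv]
    simp
  have hsq : ∀ x, fderiv ℝ (fun x => φ x ^ 2) x (EuclideanSpace.single i 1) =
      2 * φ x * fderiv ℝ φ x (EuclideanSpace.single i 1) := by
    intro x
    rw [fderiv_fun_pow 2 (hd x)]
    simp
  have hsqc : HasCompactSupport fun x => φ x ^ 2 :=
    φ.hasCompactSupport.comp_left (g := fun t : ℝ => t ^ 2) (by simp)
  have hint : Integrable fun x => φ x ^ 2 :=
    (hφc.pow 2).integrable_of_hasCompactSupport hsqc
  have hint' : Integrable fun x =>
      2 * φ x * fderiv ℝ φ x (EuclideanSpace.single i 1) * x i :=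
    (((continuous_const.mul hφc).mul hφ').mul hpc).integrable_of_hasCompactSupport
      (((φ.hasCompactSupport.mul_left).mul_right).mul_right)
  have h := integral_mul_fderiv_eq_neg_fderiv_mul_of_integrable (μ := volume)
    (f := fun x => φ x ^ 2) (g := fun x : EuclideanSpace ℝ (Fin N) => x i)
    (v := EuclideanSpace.single i 1)
    (by simpa only [hsq] using hint') (by simpa only [hpd, mul_one] using hint)
    ((hφc.pow 2).mul hpc |>.integrable_of_hasCompactSupport hsqc.mul_right)
    (fun x _ => (hd x).pow 2) (fun x _ => by fun_prop)
  simpa only [hsq, hpd, mul_one] using h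

lemma integrable_mul_norm_gradient_sq (φ : TestFunction Ω ℝ ⊤)
    {g : EuclideanSpace ℝ (Fin N) → ℝ} (hg : Continuous g) :
    Integrable fun x => g x * ‖gradient φ x‖ ^ 2 := by
  have hs : HasCompactSupport fun x => ‖gradient φ x‖ ^ 2 :=
    (hasCompactSupport_gradient_test φ).norm.comp_left (g := fun t : ℝ => t ^ 2) (by simp)
  have hc : Continuous fun x => ‖gradient φ x‖ ^ 2 := (continuous_gradient_test φ).norm.pow 2
  exact (hg.mul hc).integrable_of_hasCompactSupport hs.mul_left

lemma integrable_test_sq (φ : TestFunction Ω ℝ ⊤) : Integrable fun x => φ x ^ 2 := by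
  have hs : HasCompactSupport fun x => φ x ^ 2 :=
    φ.hasCompactSupport.comp_left (g := fun t : ℝ => t ^ 2) (by simp)
  have hc : Continuous fun x => φ x ^ 2 := φ.continuous.pow 2
  exact hc.integrable_of_hasCompactSupport hs

lemma integral_sq_test_le (hN : 0 < N) (φ : TestFunction Ω ℝ ⊤) :
    ∫ x, φ x ^ 2 ≤ 4 * ∫ x, ‖x‖ ^ 2 * ‖gradient φ x‖ ^ 2 := by
  obtain ⟨i⟩ : Nonempty (Fin N) := ⟨⟨0, hN⟩⟩
  have hφ' : Continuous fun x => fderiv ℝ φ x (EuclideanSpace.single i 1) :=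
    (φ.contDiff.continuous_fderiv (by simp)).clm_apply continuous_const
  have hpc : Continuous fun x : EuclideanSpace ℝ (Fin N) => x i := by fun_prop
  have hint := integrable_test_sq φ
  have hint' : Integrable fun x =>
      2 * φ x * fderiv ℝ φ x (EuclideanSpace.single i 1) * x i :=
    (((continuous_const.mul φ.continuous).mul hφ').mul hpc).integrable_of_hasCompactSupport
      (((φ.hasCompactSupport.mul_left).mul_right).mul_right)
  have hint2 : Integrable fun x => ‖x‖ ^ 2 * ‖gradient φ x‖ ^ 2 :=
    integrable_mul_norm_gradient_sq φ (continuous_norm.pow 2)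
  have hle : ∫ x, φ x ^ 2 ≤
      ∫ x, (1 / 2 * φ x ^ 2 + 2 * (‖x‖ ^ 2 * ‖gradient φ x‖ ^ 2)) := by
    rw [integral_sq_test φ i, ← integral_neg]
    refine integral_mono hint'.neg ((hint.const_mul _).add (hint2.const_mul _)) fun x => ?_
    have h1 : |fderiv ℝ φ x (EuclideanSpace.single i 1) * x i| ≤ ‖x‖ * ‖gradient φ x‖ := by
      rw [abs_mul, mul_comm, ← gradient_apply_coord]
      exact mul_le_mul (PiLp.norm_apply_le x i) (PiLp.norm_apply_le (gradient φ x) i)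
        (abs_nonneg _) (norm_nonneg _)
    have h2 : (fderiv ℝ φ x (EuclideanSpace.single i 1) * x i) ^ 2 ≤
        ‖x‖ ^ 2 * ‖gradient φ x‖ ^ 2 := by
      rw [← mul_pow, ← sq_abs]
      exact pow_le_pow_left₀ (abs_nonneg _) h1 2
    -- Young's inequality `-2φb ≤ φ²/2 + 2b²` with `b = x_i ∂_iφ`; absorbing `φ²/2` on the left
    -- produces the constant `4`.
    have h3 := sq_nonneg (φ x + 2 * (fderiv ℝ φ x (EuclideanSpace.single i 1) * x i))
    change -(2 * φ x * fderiv ℝ φ x (EuclideanSpace.single i 1) * x i) ≤ _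
    linarith
  rw [integral_add (hint.const_mul _) (hint2.const_mul _), integral_const_mul,
    integral_const_mul] at hle
  linarith

/-- A weighted Poincaré inequality for test functions on a bounded set. -/
lemma poincare_test (hN : 0 < N) (hα0 : 0 ≤ α) (hα2 : α ≤ 2) {R : ℝ} (hR : ∀ x ∈ Ω, ‖x‖ ≤ R)
    (φ : TestFunction Ω ℝ ⊤) :
    ∫ x, φ x ^ 2 ≤ 4 * (R ^ (2 - α) * ∫ x, weight α x * ‖gradient φ x‖ ^ 2) := by
  refine (integral_sq_test_le hN φ).trans ?_
  have hwc : Continuous (weight α : EuclideanSpace ℝ (Fin N) → ℝ) :=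
    continuous_norm.rpow_const fun _ => Or.inr hα0
  gcongr
  rw [← integral_const_mul]
  refine integral_mono (integrable_mul_norm_gradient_sq φ (continuous_norm.pow 2))
    ((integrable_mul_norm_gradient_sq φ hwc).const_mul _) fun x => ?_
  by_cases hx : x ∈ Ω
  · have h1 : ‖x‖ ^ 2 ≤ R ^ (2 - α) * weight α x := by
      have h2 : ‖x‖ ^ 2 = ‖x‖ ^ (2 - α) * ‖x‖ ^ α := by
        rw [← Real.rpow_add_of_nonneg (norm_nonneg x) (by linarith) hα0]
        simp
      rw [h2]
      exact mul_le_mul_of_nonneg_right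
        (Real.rpow_le_rpow (norm_nonneg x) (hR x hx) (by linarith)) (weight_nonneg α x)
    simp only
    rw [← mul_assoc]
    gcongr
  · simp [gradient_test_eq_zero φ hx]

/-! ### `H¹_{w,0}(Ω)` as the closure of the pairs `(φ, ∇φ)` -/

/-- The pairs `(φ, ∇φ)` of a test function and its gradient, as elements of `PairSpace Ω w`. -/
def testPairs (Ω : TopologicalSpace.Opens (EuclideanSpace ℝ (Fin N)))
    (w : EuclideanSpace ℝ (Fin N) → ℝ) : Set (PairSpace Ω w) :=
  {U | ∃ φ : TestFunction Ω ℝ ⊤,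
    U.fst =ᵐ[weightedMeasure Ω w] φ ∧ U.snd =ᵐ[weightedMeasure Ω w] gradient φ}

lemma memLp_two_of_hasCompactSupport {F : Type*} [NormedAddCommGroup F]
    {g : EuclideanSpace ℝ (Fin N) → F} (hc : Continuous g) (hs : HasCompactSupport g)
    (μ : Measure (EuclideanSpace ℝ (Fin N))) [IsFiniteMeasure μ] : MemLp g 2 μ := by
  obtain ⟨C, hC⟩ := hc.bounded_above_of_compact_support hs
  exact MemLp.of_bound (hc.aestronglyMeasurable) C (ae_of_all _ hC)

lemma ae_restrict_of_ae_weightedMeasure (hN : 0 < N) (hw : IsAdmissible Ω α M w)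
    {p : EuclideanSpace ℝ (Fin N) → Prop} (h : ∀ᵐ x ∂(weightedMeasure Ω w), p x) :
    ∀ᵐ x ∂(volume.restrict (Ω : Set (EuclideanSpace ℝ (Fin N)))), p x :=
  (absolutelyContinuous_weightedMeasure hw.measurable (hw.ae_pos hN)).ae_le h

lemma norm_sq_Lp_eq (hw : IsAdmissible Ω α M w)
    (G : Lp (EuclideanSpace ℝ (Fin N)) 2 (weightedMeasure Ω w)) :
    ‖G‖ ^ 2 = ∫ x in (Ω : Set (EuclideanSpace ℝ (Fin N))), w x * ‖G x‖ ^ 2 := by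
  rw [← real_inner_self_eq_norm_sq, L2.inner_def,
    integral_weightedMeasure hw.measurable hw.nonneg]
  simp_rw [real_inner_self_eq_norm_sq, smul_eq_mul]

lemma integrableOn_weight_mul_norm_gradient_sq (hw : IsAdmissible Ω α M w)
    (hΩ : Bornology.IsBounded (Ω : Set (EuclideanSpace ℝ (Fin N))))
    (φ : TestFunction Ω ℝ ⊤) :
    IntegrableOn (fun x => w x * ‖gradient φ x‖ ^ 2)
      (Ω : Set (EuclideanSpace ℝ (Fin N))) := by
  have := isFiniteMeasure_weightedMeasure hΩ hw
  have h := (memLp_two_of_hasCompactSupport (continuous_gradient_test φ)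
    (hasCompactSupport_gradient_test φ) (weightedMeasure Ω w)).norm.integrable_sq
  exact (integrable_weightedMeasure_iff hw.measurable hw.nonneg).1 h

lemma integral_weight_mul_norm_gradient_sq_le (hα0 : 0 ≤ α) (hw : IsAdmissible Ω α M w)
    (hΩ : Bornology.IsBounded (Ω : Set (EuclideanSpace ℝ (Fin N))))
    (φ : TestFunction Ω ℝ ⊤) :
    ∫ x, weight α x * ‖gradient φ x‖ ^ 2 ≤
      ∫ x in (Ω : Set (EuclideanSpace ℝ (Fin N))), w x * ‖gradient φ x‖ ^ 2 := by
  rw [← setIntegral_eq_integral_of_forall_compl_eq_zero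
    (s := (Ω : Set (EuclideanSpace ℝ (Fin N))))]
  · refine integral_mono (integrable_mul_norm_gradient_sq φ
      (continuous_norm.rpow_const fun _ => Or.inr hα0)).integrableOn
      (integrableOn_weight_mul_norm_gradient_sq hw hΩ φ) fun x => ?_
    exact mul_le_mul_of_nonneg_right (hw.weight_le x) (sq_nonneg _)
  · intro x hx
    simp [gradient_test_eq_zero φ hx]

/-- The constant of the weighted Poincaré inequality on a set contained in the ball of
radius `R`. -/
def poincareConst (α R : ℝ) : ℝ := √(4 * R ^ (2 - α))

lemma poincareConst_nonneg (α R : ℝ) : 0 ≤ poincareConst α R := Real.sqrt_nonneg _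

lemma eLpNorm_le_of_mem_testPairs (hN : 0 < N) (hα0 : 0 ≤ α) (hα2 : α ≤ 2)
    (hΩ : Bornology.IsBounded (Ω : Set (EuclideanSpace ℝ (Fin N))))
    {R : ℝ} (hR0 : 0 ≤ R) (hR : ∀ x ∈ Ω, ‖x‖ ≤ R)
    (hw : IsAdmissible Ω α M w) {U : PairSpace Ω w} (hU : U ∈ testPairs Ω w) :
    eLpNorm U.fst 2 (volume.restrict (Ω : Set (EuclideanSpace ℝ (Fin N)))) ≤
      ENNReal.ofReal (poincareConst α R) * ‖U.snd‖ₑ := by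
  obtain ⟨φ, h1, h2⟩ := hU
  have : IsFiniteMeasure (volume.restrict (Ω : Set (EuclideanSpace ℝ (Fin N)))) :=
    ⟨by simpa using hΩ.measure_lt_top⟩
  have h1' := ae_restrict_of_ae_weightedMeasure hN hw h1
  have h2' := ae_restrict_of_ae_weightedMeasure hN hw h2
  rw [eLpNorm_congr_ae h1', (memLp_two_of_hasCompactSupport φ.continuous φ.hasCompactSupport
    (volume.restrict (Ω : Set (EuclideanSpace ℝ (Fin N))))).eLpNorm_eq_integral_rpow_norm
    two_ne_zero ENNReal.ofNat_ne_top, ← ofReal_norm, ← ENNReal.ofReal_mul (poincareConst_nonneg α R)]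
  refine ENNReal.ofReal_le_ofReal ?_
  have h3 : ‖U.snd‖ ^ 2 =
      ∫ x in (Ω : Set (EuclideanSpace ℝ (Fin N))), w x * ‖gradient φ x‖ ^ 2 := by
    rw [norm_sq_Lp_eq hw]
    refine integral_congr_ae ?_
    filter_upwards [h2'] with x hx
    rw [hx]
  have h4 : ∫ x in (Ω : Set (EuclideanSpace ℝ (Fin N))), ‖φ x‖ ^ (2 : ENNReal).toReal ≤
      4 * R ^ (2 - α) * ‖U.snd‖ ^ 2 := by
    have h5 : ∫ x in (Ω : Set (EuclideanSpace ℝ (Fin N))), ‖φ x‖ ^ (2 : ENNReal).toReal =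
        ∫ x, φ x ^ 2 := by
      rw [setIntegral_eq_integral_of_forall_compl_eq_zero]
      · simp
      · intro x hx
        simp [test_eq_zero φ hx]
    rw [h5, h3, mul_assoc]
    refine (poincare_test hN hα0 hα2 hR φ).trans ?_
    gcongr
    exact integral_weight_mul_norm_gradient_sq_le hα0 hw hΩ φ
  have h6 : (2 : ENNReal).toReal⁻¹ = 1 / 2 := by simp
  rw [h6, ← Real.sqrt_eq_rpow]
  refine (Real.sqrt_le_sqrt h4).trans ?_
  rw [Real.sqrt_mul (by positivity), Real.sqrt_sq (norm_nonneg _), poincareConst]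

lemma continuous_pairSpace_fst : Continuous fun U : PairSpace Ω w => U.fst :=
  (WithLp.fstL 2 ℝ _ _).continuous

lemma continuous_pairSpace_snd : Continuous fun U : PairSpace Ω w => U.snd :=
  (WithLp.sndL 2 ℝ _ _).continuous

/-- Limits in `L²(Ω; w)` say nothing directly about the unweighted norm, as `w` may vanish at `0`.
An a.e. convergent subsequence and Fatou's lemma carry the bound over. -/
lemma eLpNorm_le_of_mem_closure (hN : 0 < N) (hα0 : 0 ≤ α) (hα2 : α ≤ 2)
    (hΩ : Bornology.IsBounded (Ω : Set (EuclideanSpace ℝ (Fin N))))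
    {R : ℝ} (hR0 : 0 ≤ R) (hR : ∀ x ∈ Ω, ‖x‖ ≤ R)
    (hw : IsAdmissible Ω α M w) {U : PairSpace Ω w} (hU : U ∈ closure (testPairs Ω w)) :
    eLpNorm U.fst 2 (volume.restrict (Ω : Set (EuclideanSpace ℝ (Fin N)))) ≤
      ENNReal.ofReal (poincareConst α R) * ‖U.snd‖ₑ := by
  obtain ⟨V, hVT, hV⟩ := mem_closure_iff_seq_limit.1 hU
  obtain ⟨ns, hns, hae⟩ := (tendstoInMeasure_of_tendsto_Lp
    ((continuous_pairSpace_fst.tendsto U).comp hV)).exists_seq_tendsto_ae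
  have hae' := ae_restrict_of_ae_weightedMeasure hN hw hae
  have hac := absolutelyContinuous_weightedMeasure hw.measurable (hw.ae_pos hN)
  refine (Lp.eLpNorm_lim_le_liminf_eLpNorm
    (fun n => (Lp.aestronglyMeasurable (V (ns n)).fst).mono_ac hac) _ hae').trans ?_
  have hlim : Tendsto (fun n => ENNReal.ofReal (poincareConst α R) * ‖(V (ns n)).snd‖ₑ) atTop
      (𝓝 (ENNReal.ofReal (poincareConst α R) * ‖U.snd‖ₑ)) := by
    refine ENNReal.Tendsto.const_mul ?_ (Or.inr ENNReal.ofReal_ne_top)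
    exact ((continuous_enorm.comp continuous_pairSpace_snd).tendsto U).comp
      (hV.comp hns.tendsto_atTop)
  rw [← hlim.liminf_eq]
  exact liminf_le_liminf (Eventually.of_forall fun n =>
    eLpNorm_le_of_mem_testPairs hN hα0 hα2 hΩ hR0 hR hw (hVT (ns n)))

/-- A test function and its derivatives lie in `L²(Ω; w⁻¹)`, so both sides of the defining identity
are continuous in the pair. The identity thus holds on a closed set, which contains the test pairs.
-/
lemma hasWeakGradient_of_mem_closure (hN : 0 < N) (hαN : α < N)
    (hΩ : Bornology.IsBounded (Ω : Set (EuclideanSpace ℝ (Fin N))))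
    (hw : IsAdmissible Ω α M w) {U : PairSpace Ω w} (hU : U ∈ closure (testPairs Ω w)) :
    HasWeakGradient Ω U.fst U.snd where
  locInt := (integrableOn_of_memLp_weighted hN hαN hΩ hw (Lp.memLp U.fst)).locallyIntegrableOn
  locInt_grad :=
    (integrableOn_of_memLp_weighted hN hαN hΩ hw (Lp.memLp U.snd)).locallyIntegrableOn
  integral_eq φ i := by
    have := isFiniteMeasure_weightedMeasure_inv hN hαN hΩ hw
    have hφ : MemLp φ 2 (weightedMeasure Ω fun x => (w x)⁻¹) :=
      memLp_two_of_hasCompactSupport φ.continuous φ.hasCompactSupport _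
    have hφ' : MemLp (fun x => fderiv ℝ φ x (EuclideanSpace.single i 1)) 2
        (weightedMeasure Ω fun x => (w x)⁻¹) :=
      memLp_two_of_hasCompactSupport
        ((φ.contDiff.continuous_fderiv (by simp)).clm_apply continuous_const)
        (φ.hasCompactSupport.fderiv_apply ℝ _) _
    let P : EuclideanSpace ℝ (Fin N) →L[ℝ] ℝ := EuclideanSpace.proj i
    have e1 : ∀ V : PairSpace Ω w, ∫ x in (Ω : Set (EuclideanSpace ℝ (Fin N))),
        V.fst x * fderiv ℝ φ x (EuclideanSpace.single i 1) =
        inner ℝ ((memLp_div_weight hN hw hφ').toLp) V.fst := by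
      intro V
      rw [← integral_mul_eq_inner hN hw hφ']
      simp_rw [mul_comm]
    have e2 : ∀ V : PairSpace Ω w, ∫ x in (Ω : Set (EuclideanSpace ℝ (Fin N))),
        V.snd x i * φ x =
        inner ℝ ((memLp_div_weight hN hw hφ).toLp) (P.compLp V.snd) := by
      intro V
      rw [← integral_mul_eq_inner hN hw hφ]
      refine integral_congr_ae ?_
      filter_upwards [ae_restrict_of_ae_weightedMeasure hN hw (P.coeFn_compLp V.snd)] with x hx
      rw [hx, mul_comm]
      rfl
    rw [e1, e2]
    have hclosed : IsClosed {V : PairSpace Ω w |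
        inner ℝ ((memLp_div_weight hN hw hφ').toLp) V.fst =
          - inner ℝ ((memLp_div_weight hN hw hφ).toLp) (P.compLp V.snd)} := by
      refine isClosed_eq ?_ ?_
      · exact continuous_const.inner continuous_pairSpace_fst
      · exact (continuous_const.inner ((P.compLpL 2 (weightedMeasure Ω w)).continuous.comp
          continuous_pairSpace_snd)).neg
    refine hclosed.closure_subset_iff.2 ?_ hU
    rintro V ⟨ψ, h1, h2⟩
    change _ = _
    rw [← e1, ← e2]
    refine Eq.trans ?_ (((hasWeakGradient_test ψ).integral_eq φ i).trans (congrArg Neg.neg ?_))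
    · refine integral_congr_ae ?_
      filter_upwards [ae_restrict_of_ae_weightedMeasure hN hw h1] with x hx
      rw [hx]
    · refine integral_congr_ae ?_
      filter_upwards [ae_restrict_of_ae_weightedMeasure hN hw h2] with x hx
      rw [hx]

lemma closure_testPairs_subset_H1 (hN : 0 < N) (hα0 : 0 ≤ α) (hα2 : α ≤ 2) (hαN : α < N)
    (hΩ : Bornology.IsBounded (Ω : Set (EuclideanSpace ℝ (Fin N))))
    (hw : IsAdmissible Ω α M w) : closure (testPairs Ω w) ⊆ H1 Ω w := by
  intro U hU
  obtain ⟨R, hR0, hR⟩ := hΩ.exists_pos_norm_le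
  refine ⟨U.fst, U.snd, ⟨?_, ?_⟩,
    hasWeakGradient_of_mem_closure hN hαN hΩ hw hU, ae_eq_rfl, ae_eq_rfl⟩
  · exact (Lp.aestronglyMeasurable U.fst).mono_ac
      (absolutelyContinuous_weightedMeasure hw.measurable (hw.ae_pos hN))
  · exact (eLpNorm_le_of_mem_closure hN hα0 hα2 hΩ hR0.le hR hw hU).trans_lt
      (ENNReal.mul_lt_top ENNReal.ofReal_lt_top enorm_lt_top)

/-- `testSubspace` constrains only the function; uniqueness of weak gradients forces the second
component to be `∇φ`. -/
lemma image_testSubspace (hN : 0 < N) (hα0 : 0 ≤ α) (hα2 : α ≤ 2) (hαN : α < N)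
    (hΩ : Bornology.IsBounded (Ω : Set (EuclideanSpace ℝ (Fin N))))
    (hw : IsAdmissible Ω α M w) :
    ((↑) : H1 Ω w → PairSpace Ω w) '' (testSubspace Ω w : Set (H1 Ω w)) = testPairs Ω w := by
  ext U
  constructor
  · rintro ⟨V, ⟨φ, hφ⟩, rfl⟩
    obtain ⟨u, G, -, hG, h1, h2⟩ := V.2
    refine ⟨φ, hφ, h2.trans ?_⟩
    refine (weightedMeasure_absolutelyContinuous Ω w).ae_le
      (hG.ae_unique (hasWeakGradient_test φ) ?_)
    exact ae_restrict_of_ae_weightedMeasure hN hw (h1.symm.trans hφ)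
  · intro hU
    have hU1 := closure_testPairs_subset_H1 hN hα0 hα2 hαN hΩ hw (subset_closure hU)
    obtain ⟨φ, h1, h2⟩ := hU
    exact ⟨⟨U, hU1⟩, ⟨φ, h1⟩, rfl⟩

lemma mem_H10_iff (hN : 0 < N) (hα0 : 0 ≤ α) (hα2 : α ≤ 2) (hαN : α < N)
    (hΩ : Bornology.IsBounded (Ω : Set (EuclideanSpace ℝ (Fin N))))
    (hw : IsAdmissible Ω α M w) (U : H1 Ω w) :
    U ∈ H10 Ω w ↔ (U : PairSpace Ω w) ∈ closure (testPairs Ω w) := by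
  rw [← image_testSubspace hN hα0 hα2 hαN hΩ hw, ← closure_subtype]
  rfl

/-- The closure of the test pairs in the complete space `PairSpace` already lies in `H1`, so
completeness of `H1` itself is not needed. -/
lemma completeSpace_H10 (hN : 0 < N) (hα0 : 0 ≤ α) (hα2 : α ≤ 2) (hαN : α < N)
    (hΩ : Bornology.IsBounded (Ω : Set (EuclideanSpace ℝ (Fin N))))
    (hw : IsAdmissible Ω α M w) : CompleteSpace (H10 Ω w) := by
  have hi : IsUniformInducing fun U : H10 Ω w => (U.1.1 : PairSpace Ω w) :=
    isUniformInducing_val _ |>.comp (isUniformInducing_val _)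
  rw [completeSpace_iff_isComplete_univ, ← hi.isComplete_iff, Set.image_univ]
  have : Set.range (fun U : H10 Ω w => (U.1.1 : PairSpace Ω w)) = closure (testPairs Ω w) := by
    ext U
    constructor
    · rintro ⟨V, rfl⟩
      exact (mem_H10_iff hN hα0 hα2 hαN hΩ hw V.1).1 V.2
    · intro hU
      have hU1 := closure_testPairs_subset_H1 hN hα0 hα2 hαN hΩ hw hU
      exact ⟨⟨⟨U, hU1⟩, (mem_H10_iff hN hα0 hα2 hαN hΩ hw ⟨U, hU1⟩).2 hU⟩, rfl⟩
  rw [this]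
  exact isClosed_closure.isComplete

/-! ### Coercivity of the energy, existence and uniqueness of weak solutions -/

/-- The function underlying an element of `H¹_{w,0}(Ω)`, as an element of `L²(Ω; w)`. -/
def fnL (Ω : TopologicalSpace.Opens (EuclideanSpace ℝ (Fin N)))
    (w : EuclideanSpace ℝ (Fin N) → ℝ) :
    H10 Ω w →L[ℝ] Lp ℝ 2 (weightedMeasure Ω w) :=
  (WithLp.fstL 2 ℝ _ _).comp ((H1 Ω w).subtypeL.comp (H10 Ω w).subtypeL)

/-- The gradient as a bounded operator from `H¹_{w,0}(Ω)` to `L²(Ω; w)^N`. -/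
def gradL (Ω : TopologicalSpace.Opens (EuclideanSpace ℝ (Fin N)))
    (w : EuclideanSpace ℝ (Fin N) → ℝ) :
    H10 Ω w →L[ℝ] Lp (EuclideanSpace ℝ (Fin N)) 2 (weightedMeasure Ω w) :=
  (WithLp.sndL 2 ℝ _ _).comp ((H1 Ω w).subtypeL.comp (H10 Ω w).subtypeL)

lemma norm_sq_H10 (u : H10 Ω w) : ‖u‖ ^ 2 = ‖fnL Ω w u‖ ^ 2 + ‖gradL Ω w u‖ ^ 2 :=
  WithLp.prod_norm_sq_eq_of_L2 (u.1.1 : PairSpace Ω w)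

lemma norm_gradL_le (u : H10 Ω w) : ‖gradL Ω w u‖ ≤ ‖u‖ := by
  refine le_of_sq_le_sq ?_ (norm_nonneg _)
  rw [norm_sq_H10]
  exact le_add_of_nonneg_left (sq_nonneg _)

lemma gradL_sub (u v : H10 Ω w) : gradL Ω w (u - v) = gradL Ω w u - gradL Ω w v :=
  (gradL Ω w).map_sub u v

lemma eLpNorm_fn_le (hN : 0 < N) (hα0 : 0 ≤ α) (hα2 : α ≤ 2) (hαN : α < N)
    (hΩ : Bornology.IsBounded (Ω : Set (EuclideanSpace ℝ (Fin N))))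
    {R : ℝ} (hR0 : 0 ≤ R) (hR : ∀ x ∈ Ω, ‖x‖ ≤ R) (hw : IsAdmissible Ω α M w)
    (u : H10 Ω w) :
    eLpNorm (fn u) 2 (volume.restrict (Ω : Set (EuclideanSpace ℝ (Fin N)))) ≤
      ENNReal.ofReal (poincareConst α R) * ‖gradL Ω w u‖ₑ :=
  eLpNorm_le_of_mem_closure hN hα0 hα2 hΩ hR0 hR hw
    ((mem_H10_iff hN hα0 hα2 hαN hΩ hw u.1).1 u.2)

/-- The upper bound `w ≤ M` turns the unweighted Poincaré inequality into one for the norm of `L²(Ω;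
w)`, so the energy is coercive. -/
lemma exists_norm_le_gradL (hN : 0 < N) (hα0 : 0 ≤ α) (hα2 : α ≤ 2) (hαN : α < N)
    (hΩ : Bornology.IsBounded (Ω : Set (EuclideanSpace ℝ (Fin N))))
    (hw : IsAdmissible Ω α M w) :
    ∃ K : ℝ, 0 < K ∧ ∀ u : H10 Ω w, ‖u‖ ≤ K * ‖gradL Ω w u‖ := by
  obtain ⟨R, hR0, hR⟩ := hΩ.exists_pos_norm_le
  have hle : weightedMeasure Ω w ≤
      ENNReal.ofReal M • volume.restrict (Ω : Set (EuclideanSpace ℝ (Fin N))) := by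
    rw [← withDensity_const]
    refine withDensity_mono ?_
    filter_upwards [ae_restrict_mem Ω.isOpen.measurableSet] with x hx
    exact ENNReal.ofReal_le_ofReal (hw.le_bound x hx)
  have hfn : ∃ C : ℝ, 0 ≤ C ∧ ∀ u : H10 Ω w, ‖fnL Ω w u‖ ≤ C * ‖gradL Ω w u‖ := by
    refine ⟨(ENNReal.ofReal M ^ (1 / (2 : ENNReal)).toReal).toReal * poincareConst α R,
      mul_nonneg ENNReal.toReal_nonneg (poincareConst_nonneg α R), fun u => ?_⟩
    have h1 : eLpNorm (fn u) 2 (weightedMeasure Ω w) ≤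
        ENNReal.ofReal M ^ (1 / (2 : ENNReal)).toReal *
          (ENNReal.ofReal (poincareConst α R) * ‖gradL Ω w u‖ₑ) := by
      refine (eLpNorm_mono_measure _ hle).trans ?_
      rw [eLpNorm_smul_measure_of_ne_top (by simp), smul_eq_mul]
      exact mul_le_mul' le_rfl (eLpNorm_fn_le hN hα0 hα2 hαN hΩ hR0.le hR hw u)
    have hfin : ENNReal.ofReal M ^ (1 / (2 : ENNReal)).toReal ≠ ⊤ :=
      ENNReal.rpow_ne_top_of_nonneg (by positivity) ENNReal.ofReal_ne_top
    have h2 := ENNReal.toReal_mono (ENNReal.mul_ne_top hfin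
      (ENNReal.mul_ne_top ENNReal.ofReal_ne_top enorm_ne_top)) h1
    rwa [ENNReal.toReal_mul, ENNReal.toReal_mul, ENNReal.toReal_ofReal (poincareConst_nonneg α R),
      toReal_enorm, ← mul_assoc] at h2
  obtain ⟨C, hC, hfn⟩ := hfn
  -- `‖u‖² ≤ (C² + 1) ‖∇u‖² ≤ (C + 1)² ‖∇u‖²`.
  refine ⟨C + 1, by positivity, fun u => le_of_sq_le_sq ?_ (by positivity)⟩
  rw [norm_sq_H10]
  have h1 := pow_le_pow_left₀ (norm_nonneg _) (hfn u) 2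
  nlinarith [mul_nonneg hC (sq_nonneg ‖gradL Ω w u‖)]

lemma inner_gradL (hw : IsAdmissible Ω α M w) (u v : H10 Ω w) :
    inner ℝ (gradL Ω w u) (gradL Ω w v) =
      ∫ x in (Ω : Set (EuclideanSpace ℝ (Fin N))), inner ℝ (grad u x) (grad v x) * w x := by
  rw [L2.inner_def, integral_weightedMeasure hw.measurable hw.nonneg]
  simp_rw [smul_eq_mul, mul_comm (w _)]
  rfl

lemma isWeakSolution_iff (hw : IsAdmissible Ω α M w) {f : EuclideanSpace ℝ (Fin N) → ℝ}
    {u : H10 Ω w} : IsWeakSolution f u ↔ ∀ v : H10 Ω w, inner ℝ (gradL Ω w u) (gradL Ω w v) =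
      ∫ x in (Ω : Set (EuclideanSpace ℝ (Fin N))), f x * fn v x := by
  simp_rw [inner_gradL hw]
  rfl

/-- Lax-Milgram for the form `(u, v) ↦ ⟨G u, G v⟩`, coercive with constant `K⁻²`. -/
lemma exists_forall_inner_map_eq {V W : Type*} [NormedAddCommGroup V] [InnerProductSpace ℝ V]
    [CompleteSpace V] [NormedAddCommGroup W] [InnerProductSpace ℝ W] (G : V →L[ℝ] W) {K : ℝ}
    (hK : 0 < K) (hb : ∀ u, ‖u‖ ≤ K * ‖G u‖) (F : V →L[ℝ] ℝ) :
    ∃ u, ∀ v, inner ℝ (G u) (G v) = F v := by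
  let B : V →L[ℝ] V →L[ℝ] ℝ := (innerSL ℝ).bilinearComp G G
  have hB : ∀ u v, B u v = inner ℝ (G u) (G v) := fun u v => rfl
  have hcoer : IsCoercive B := by
    refine ⟨(K ^ 2)⁻¹, by positivity, fun u => ?_⟩
    rw [hB, real_inner_self_eq_norm_sq, mul_assoc, inv_mul_le_iff₀ (by positivity), ← sq,
      ← mul_pow]
    exact pow_le_pow_left₀ (norm_nonneg _) (hb u) 2
  refine ⟨hcoer.continuousLinearEquivOfBilin.symm ((InnerProductSpace.toDual ℝ V).symm F),
    fun v => ?_⟩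
  rw [← hB, ← hcoer.continuousLinearEquivOfBilin_apply, ContinuousLinearEquiv.apply_symm_apply,
    InnerProductSpace.toDual_symm_apply]

lemma exists_mem_forall_inner_map_eq {E A B : Type*} [NormedAddCommGroup E]
    [InnerProductSpace ℝ E] [NormedAddCommGroup A] [InnerProductSpace ℝ A]
    [NormedAddCommGroup B] [InnerProductSpace ℝ B] (p : E →L[ℝ] A) (q : E →L[ℝ] B)
    (H : Submodule ℝ E) (V : Submodule ℝ H) [CompleteSpace V] {K : ℝ}
    (hK : 0 < K) (hb : ∀ u : V, ‖u‖ ≤ K * ‖q u.1.1‖) (g : A) :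
    ∃ u : V, ∀ v : V, inner ℝ (q u.1.1) (q v.1.1) = inner ℝ g (p v.1.1) := by
  let Q : V →L[ℝ] B := q.comp (H.subtypeL.comp V.subtypeL)
  let F : V →L[ℝ] ℝ := (innerSL ℝ g).comp (p.comp (H.subtypeL.comp V.subtypeL))
  obtain ⟨u, hu⟩ := exists_forall_inner_map_eq (V := V) (W := B) Q hK hb F
  exact ⟨u, hu⟩

/-- Existence of a weak solution, by the Lax-Milgram theorem. -/
lemma exists_isWeakSolution (hN : 0 < N) (hα0 : 0 ≤ α) (hα2 : α ≤ 2) (hαN : α < N)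
    (hΩ : Bornology.IsBounded (Ω : Set (EuclideanSpace ℝ (Fin N))))
    (hw : IsAdmissible Ω α M w) {f : EuclideanSpace ℝ (Fin N) → ℝ}
    (hf : MemLp f 2 (weightedMeasure Ω fun x => (w x)⁻¹)) :
    ∃ u : H10 Ω w, IsWeakSolution f u := by
  have := completeSpace_H10 hN hα0 hα2 hαN hΩ hw
  obtain ⟨K, hK, hb⟩ := exists_norm_le_gradL hN hα0 hα2 hαN hΩ hw
  obtain ⟨u, hu⟩ := exists_mem_forall_inner_map_eq (WithLp.fstL 2 ℝ _ _)
    (WithLp.sndL 2 ℝ _ _) (H1 Ω w) (H10 Ω w) hK hb (memLp_div_weight hN hw hf).toLp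
  refine ⟨u, (isWeakSolution_iff hw).2 fun v => (hu v).trans ?_⟩
  exact (integral_mul_eq_inner hN hw hf (fnL Ω w v)).symm

lemma IsWeakSolution.unique (hN : 0 < N) (hα0 : 0 ≤ α) (hα2 : α ≤ 2) (hαN : α < N)
    (hΩ : Bornology.IsBounded (Ω : Set (EuclideanSpace ℝ (Fin N))))
    (hw : IsAdmissible Ω α M w) {f : EuclideanSpace ℝ (Fin N) → ℝ} {u v : H10 Ω w}
    (hu : IsWeakSolution f u) (hv : IsWeakSolution f v) : u = v := by
  rw [isWeakSolution_iff hw] at hu hv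
  obtain ⟨K, hK, hb⟩ := exists_norm_le_gradL hN hα0 hα2 hαN hΩ hw
  have h1 : inner ℝ (gradL Ω w (u - v)) (gradL Ω w (u - v)) = 0 := by
    nth_rewrite 1 [gradL_sub]
    rw [inner_sub_left, hu, hv, sub_self]
  have h2 := hb (u - v)
  rw [inner_self_eq_zero.1 h1, norm_zero, mul_zero] at h2
  exact sub_eq_zero.1 (norm_le_zero_iff.1 h2)

/-! ### Changing the weight -/

lemma continuous_toLp_mono_measure {X F : Type*} [MeasurableSpace X] [NormedAddCommGroup F]
    {μ ν : Measure X} (h : μ ≤ ν) :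
    Continuous fun g : Lp F 2 ν => ((Lp.memLp g).mono_measure h).toLp (μ := μ) := by
  refine LipschitzWith.continuous (K := 1) fun g g' => ?_
  rw [Lp.edist_toLp_toLp, Lp.edist_def, ENNReal.coe_one, one_mul]
  exact eLpNorm_mono_measure _ h

/-- The embedding of `H¹_{w',0}(Ω)` into `H¹_{w,0}(Ω)` for `w ≤ w'`. -/
lemma exists_H10_of_weight_le (hN : 0 < N) (hα0 : 0 ≤ α) (hα2 : α ≤ 2) (hαN : α < N)
    (hΩ : Bornology.IsBounded (Ω : Set (EuclideanSpace ℝ (Fin N))))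
    (hw : IsAdmissible Ω α M w) (hw' : IsAdmissible Ω α M' w') (hle : ∀ x, w x ≤ w' x)
    (u : H10 Ω w') : ∃ v : H10 Ω w,
      fn v =ᵐ[volume.restrict (Ω : Set (EuclideanSpace ℝ (Fin N)))] fn u ∧
      grad v =ᵐ[volume.restrict (Ω : Set (EuclideanSpace ℝ (Fin N)))] grad u := by
  have hμ : weightedMeasure Ω w ≤ weightedMeasure Ω w' := weightedMeasure_mono hle
  let J : PairSpace Ω w' → PairSpace Ω w := fun U => WithLp.toLp 2
    (((Lp.memLp U.fst).mono_measure hμ).toLp, ((Lp.memLp U.snd).mono_measure hμ).toLp)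
  have hJ : Continuous J := (WithLp.prod_continuous_toLp 2 _ _).comp
    (((continuous_toLp_mono_measure hμ).comp continuous_pairSpace_fst).prodMk
      ((continuous_toLp_mono_measure hμ).comp continuous_pairSpace_snd))
  have h1 : ∀ U, (J U).fst =ᵐ[weightedMeasure Ω w] U.fst := fun U =>
    MemLp.coeFn_toLp ((Lp.memLp U.fst).mono_measure hμ)
  have h2 : ∀ U, (J U).snd =ᵐ[weightedMeasure Ω w] U.snd := fun U =>
    MemLp.coeFn_toLp ((Lp.memLp U.snd).mono_measure hμ)
  have hmaps : Set.MapsTo J (testPairs Ω w') (testPairs Ω w) := by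
    rintro U ⟨φ, hφ1, hφ2⟩
    exact ⟨φ, (h1 U).trans (Measure.absolutelyContinuous_of_le hμ |>.ae_le hφ1),
      (h2 U).trans (Measure.absolutelyContinuous_of_le hμ |>.ae_le hφ2)⟩
  -- Restriction to the smaller measure is continuous and sends test pairs to test pairs, so it
  -- respects closures.
  have hmem := map_mem_closure hJ ((mem_H10_iff hN hα0 hα2 hαN hΩ hw' u.1).1 u.2) hmaps
  have hmem1 := closure_testPairs_subset_H1 hN hα0 hα2 hαN hΩ hw hmem
  exact ⟨⟨⟨_, hmem1⟩, (mem_H10_iff hN hα0 hα2 hαN hΩ hw ⟨_, hmem1⟩).2 hmem⟩,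
    ae_restrict_of_ae_weightedMeasure hN hw (h1 _), ae_restrict_of_ae_weightedMeasure hN hw (h2 _)⟩

/-- A test function as an element of `H¹_{w,0}(Ω)`. -/
lemma exists_H10_test (hN : 0 < N) (hα0 : 0 ≤ α) (hα2 : α ≤ 2) (hαN : α < N)
    (hΩ : Bornology.IsBounded (Ω : Set (EuclideanSpace ℝ (Fin N))))
    (hw : IsAdmissible Ω α M w) (φ : TestFunction Ω ℝ ⊤) : ∃ v : H10 Ω w,
      fn v =ᵐ[volume.restrict (Ω : Set (EuclideanSpace ℝ (Fin N)))] φ ∧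
      grad v =ᵐ[volume.restrict (Ω : Set (EuclideanSpace ℝ (Fin N)))] gradient φ := by
  have := isFiniteMeasure_weightedMeasure hΩ hw
  have m1 := memLp_two_of_hasCompactSupport φ.continuous φ.hasCompactSupport
    (weightedMeasure Ω w)
  have m2 := memLp_two_of_hasCompactSupport (continuous_gradient_test φ)
    (hasCompactSupport_gradient_test φ) (weightedMeasure Ω w)
  let U : PairSpace Ω w := WithLp.toLp 2 (m1.toLp, m2.toLp)
  have hU : U ∈ closure (testPairs Ω w) :=
    subset_closure ⟨φ, m1.coeFn_toLp, m2.coeFn_toLp⟩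
  have hU1 := closure_testPairs_subset_H1 hN hα0 hα2 hαN hΩ hw hU
  exact ⟨⟨⟨U, hU1⟩, (mem_H10_iff hN hα0 hα2 hαN hΩ hw ⟨U, hU1⟩).2 hU⟩,
    ae_restrict_of_ae_weightedMeasure hN hw m1.coeFn_toLp,
    ae_restrict_of_ae_weightedMeasure hN hw m2.coeFn_toLp⟩

/-! ### Convergence in the energy norm -/

lemma exists_test_norm_sub_lt (hN : 0 < N) (hα0 : 0 ≤ α) (hα2 : α ≤ 2) (hαN : α < N)
    (hΩ : Bornology.IsBounded (Ω : Set (EuclideanSpace ℝ (Fin N))))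
    (hw : IsAdmissible Ω α M w) (u : H10 Ω w) {δ : ℝ} (hδ : 0 < δ) :
    ∃ (φ : TestFunction Ω ℝ ⊤) (v : H10 Ω w),
      fn v =ᵐ[volume.restrict (Ω : Set (EuclideanSpace ℝ (Fin N)))] φ ∧
      grad v =ᵐ[volume.restrict (Ω : Set (EuclideanSpace ℝ (Fin N)))] gradient φ ∧
      ‖v - u‖ < δ := by
  obtain ⟨b, hb, hub⟩ := Metric.mem_closure_iff.1 (show u.1 ∈ closure _ from u.2) δ hδ
  have hbT : (b : PairSpace Ω w) ∈ testPairs Ω w := by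
    rw [← image_testSubspace hN hα0 hα2 hαN hΩ hw]
    exact ⟨b, hb, rfl⟩
  obtain ⟨φ, h1, h2⟩ := hbT
  refine ⟨φ, ⟨b, subset_closure hb⟩, ae_restrict_of_ae_weightedMeasure hN hw h1,
    ae_restrict_of_ae_weightedMeasure hN hw h2, ?_⟩
  rw [dist_comm, dist_eq_norm] at hub
  exact hub

lemma norm_sq_gradL_of_test (hw : IsAdmissible Ω α M w) {u : H10 Ω w} {φ : TestFunction Ω ℝ ⊤}
    (h : grad u =ᵐ[volume.restrict (Ω : Set (EuclideanSpace ℝ (Fin N)))] gradient φ) :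
    ‖gradL Ω w u‖ ^ 2 =
      ∫ x in (Ω : Set (EuclideanSpace ℝ (Fin N))), w x * ‖gradient φ x‖ ^ 2 := by
  rw [norm_sq_Lp_eq hw]
  refine integral_congr_ae ?_
  filter_upwards [h] with x hx
  rw [← hx]
  rfl

lemma norm_gradL_le_of_weight_le (hle : ∀ x, w x ≤ w' x) {u : H10 Ω w'} {v : H10 Ω w}
    (h : grad v =ᵐ[volume.restrict (Ω : Set (EuclideanSpace ℝ (Fin N)))] grad u) :
    ‖gradL Ω w v‖ ≤ ‖gradL Ω w' u‖ := by
  rw [Lp.norm_def, Lp.norm_def]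
  refine ENNReal.toReal_mono (Lp.eLpNorm_ne_top _) ?_
  have h' : gradL Ω w v =ᵐ[weightedMeasure Ω w] gradL Ω w' u :=
    (weightedMeasure_absolutelyContinuous Ω w).ae_le h
  rw [eLpNorm_congr_ae h']
  exact eLpNorm_mono_measure _ (weightedMeasure_mono hle)

/-- Here `a`, `a'` are the gradient of `u_k` in the two weighted spaces, `b`, `b'` that of a
competitor, and `c` that of `u₀`. Expanding squares, the right side equals `‖c‖² - ‖a'‖² + ‖a' -
b'‖²`, while the left side is at most `‖c‖² - ‖a'‖²`. -/
lemma norm_sq_sub_le_of_inner_eq {V V' : Type*} [NormedAddCommGroup V] [InnerProductSpace ℝ V]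
    [NormedAddCommGroup V'] [InnerProductSpace ℝ V'] {a b c : V} {a' b' : V'}
    (h1 : inner ℝ a' a' = inner ℝ c a) (h2 : inner ℝ a' b' = inner ℝ c b)
    (hle : ‖a‖ ≤ ‖a'‖) :
    ‖a - c‖ ^ 2 ≤ ‖b - c‖ ^ 2 + (‖b'‖ ^ 2 - ‖b‖ ^ 2) := by
  rw [real_inner_self_eq_norm_sq] at h1
  have h5 := norm_sub_sq_real a' b'
  have h6 := pow_le_pow_left₀ (norm_nonneg _) hle 2
  have h7 := sq_nonneg ‖a' - b'‖
  rw [norm_sub_rev a, norm_sub_rev b, norm_sub_sq_real, norm_sub_sq_real]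
  linarith

/-- The energy error of a weak solution for a larger weight is bounded by the approximation error
of any test function plus the variation of the energy of that test function. -/
lemma IsWeakSolution.norm_sq_gradL_sub_le (hN : 0 < N) (hα0 : 0 ≤ α) (hα2 : α ≤ 2) (hαN : α < N)
    (hΩ : Bornology.IsBounded (Ω : Set (EuclideanSpace ℝ (Fin N))))
    (hw : IsAdmissible Ω α M w) (hw' : IsAdmissible Ω α M' w') (hle : ∀ x, w x ≤ w' x)
    {f : EuclideanSpace ℝ (Fin N) → ℝ} {u' : H10 Ω w'} {v u₀ Φ : H10 Ω w}
    (hu' : IsWeakSolution f u') (hu₀ : IsWeakSolution f u₀)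
    (hv : fn v =ᵐ[volume.restrict (Ω : Set (EuclideanSpace ℝ (Fin N)))] fn u')
    (hgv : grad v =ᵐ[volume.restrict (Ω : Set (EuclideanSpace ℝ (Fin N)))] grad u')
    {φ : TestFunction Ω ℝ ⊤}
    (hΦ : fn Φ =ᵐ[volume.restrict (Ω : Set (EuclideanSpace ℝ (Fin N)))] φ)
    (hgΦ : grad Φ =ᵐ[volume.restrict (Ω : Set (EuclideanSpace ℝ (Fin N)))] gradient φ) :
    ‖gradL Ω w v - gradL Ω w u₀‖ ^ 2 ≤ ‖gradL Ω w Φ - gradL Ω w u₀‖ ^ 2 +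
      ((∫ x in (Ω : Set (EuclideanSpace ℝ (Fin N))), w' x * ‖gradient φ x‖ ^ 2) -
        ∫ x in (Ω : Set (EuclideanSpace ℝ (Fin N))), w x * ‖gradient φ x‖ ^ 2) := by
  -- The competitor must lie in the spaces of both weights; a test function does.
  obtain ⟨Φ', hΦ', hgΦ'⟩ := exists_H10_test hN hα0 hα2 hαN hΩ hw' φ
  rw [isWeakSolution_iff hw'] at hu'
  rw [isWeakSolution_iff hw] at hu₀
  have e1 : ∫ x in (Ω : Set (EuclideanSpace ℝ (Fin N))), f x * fn v x =
      ∫ x in (Ω : Set (EuclideanSpace ℝ (Fin N))), f x * fn u' x := by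
    refine integral_congr_ae ?_
    filter_upwards [hv] with x hx
    rw [hx]
  have e2 : ∫ x in (Ω : Set (EuclideanSpace ℝ (Fin N))), f x * fn Φ x =
      ∫ x in (Ω : Set (EuclideanSpace ℝ (Fin N))), f x * fn Φ' x := by
    refine integral_congr_ae ?_
    filter_upwards [hΦ, hΦ'] with x hx hx'
    rw [hx, hx']
  rw [← norm_sq_gradL_of_test hw' hgΦ', ← norm_sq_gradL_of_test hw hgΦ]
  exact norm_sq_sub_le_of_inner_eq ((hu' u').trans (e1.symm.trans (hu₀ v).symm))
    ((hu' Φ').trans (e2.symm.trans (hu₀ Φ).symm)) (norm_gradL_le_of_weight_le hle hgv)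

lemma integral_regWeight_sub_le (hα0 : 0 ≤ α)
    (hΩ : Bornology.IsBounded (Ω : Set (EuclideanSpace ℝ (Fin N)))) {ε : ℝ} (hε : 0 ≤ ε)
    (φ : TestFunction Ω ℝ ⊤) :
    (∫ x in (Ω : Set (EuclideanSpace ℝ (Fin N))), regWeight α ε x * ‖gradient φ x‖ ^ 2) -
        ∫ x in (Ω : Set (EuclideanSpace ℝ (Fin N))), weight α x * ‖gradient φ x‖ ^ 2 ≤
      ε ^ α * ∫ x, ‖gradient φ x‖ ^ 2 := by
  obtain ⟨R, hR0, hR⟩ := hΩ.exists_pos_norm_le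
  have h1 := integrableOn_weight_mul_norm_gradient_sq (isAdmissible_weight hα0 hR) hΩ φ
  have h2 := integrableOn_weight_mul_norm_gradient_sq (isAdmissible_regWeight hα0 hε hR) hΩ φ
  have h3 : Integrable fun x => ε ^ α * ‖gradient φ x‖ ^ 2 :=
    integrable_mul_norm_gradient_sq φ (g := fun _ => ε ^ α) continuous_const
  have h4 : ∫ x in (Ω : Set (EuclideanSpace ℝ (Fin N))), ε ^ α * ‖gradient φ x‖ ^ 2 =
      ∫ x, ε ^ α * ‖gradient φ x‖ ^ 2 := by
    refine setIntegral_eq_integral_of_forall_compl_eq_zero fun x hx => ?_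
    rw [gradient_test_eq_zero φ hx, norm_zero, zero_pow two_ne_zero, mul_zero]
  have h5 : ∀ x, regWeight α ε x * ‖gradient φ x‖ ^ 2 - weight α x * ‖gradient φ x‖ ^ 2 ≤
      ε ^ α * ‖gradient φ x‖ ^ 2 := by
    intro x
    have := mul_le_mul_of_nonneg_right (regWeight_le hα0 hε x) (sq_nonneg ‖gradient φ x‖)
    linarith
  have h6 := integral_mono (h2.sub h1) h3.integrableOn h5
  rw [h4, integral_const_mul] at h6
  rwa [← integral_sub h2 h1]

/-- Weak solutions for the regularized weights converge in the energy norm. -/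
lemma tendsto_norm_gradL_sub (hN : 0 < N) (hα0 : 0 < α) (hα2 : α ≤ 2) (hαN : α < N)
    (hΩ : Bornology.IsBounded (Ω : Set (EuclideanSpace ℝ (Fin N))))
    {f : EuclideanSpace ℝ (Fin N) → ℝ} {u : ∀ k : ℕ, H10 Ω (regWeight α (1 / (k : ℝ)))}
    (hu : ∀ k : ℕ, 1 ≤ k → IsWeakSolution f (u k)) {v : ℕ → H10 Ω (weight α)}
    (hv : ∀ k, fn (v k) =ᵐ[volume.restrict (Ω : Set (EuclideanSpace ℝ (Fin N)))] fn (u k))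
    (hgv : ∀ k, grad (v k) =ᵐ[volume.restrict (Ω : Set (EuclideanSpace ℝ (Fin N)))] grad (u k))
    {u₀ : H10 Ω (weight α)} (hu₀ : IsWeakSolution f u₀) :
    Tendsto (fun k => ‖gradL Ω (weight α) (v k - u₀)‖) atTop (𝓝 0) := by
  obtain ⟨R, hR0, hR⟩ := hΩ.exists_pos_norm_le
  have hw : IsAdmissible Ω α (R ^ α) (weight α) := isAdmissible_weight hα0.le hR
  rw [Metric.tendsto_atTop]
  intro δ hδ
  -- `φ` is fixed before `k` grows, since `∫ |∇φ|²` depends on it. The two errors add up to less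
  -- than `δ²/4 + δ²/2 < δ²`.
  obtain ⟨φ, Φ, hΦ, hgΦ, hlt⟩ := exists_test_norm_sub_lt hN hα0.le hα2 hαN hΩ hw u₀ (half_pos hδ)
  have hsmall : Tendsto (fun k : ℕ => (1 / (k : ℝ)) ^ α * ∫ x, ‖gradient φ x‖ ^ 2) atTop
      (𝓝 0) := by
    have h1 : Tendsto (fun k : ℕ => (1 / (k : ℝ)) ^ α) atTop (𝓝 0) := by
      have h2 := tendsto_one_div_atTop_nhds_zero_nat.rpow_const (p := α) (Or.inr hα0.le)
      rwa [Real.zero_rpow hα0.ne'] at h2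
    simpa using h1.mul_const (∫ x, ‖gradient φ x‖ ^ 2)
  obtain ⟨n, hn⟩ := eventually_atTop.1
    (hsmall.eventually_lt_const (show (0 : ℝ) < δ ^ 2 / 2 by positivity))
  refine ⟨max n 1, fun k hk => ?_⟩
  have hε : (0 : ℝ) ≤ 1 / (k : ℝ) := by positivity
  have h1 := IsWeakSolution.norm_sq_gradL_sub_le hN hα0.le hα2 hαN hΩ hw
    (isAdmissible_regWeight hα0.le hε hR) (weight_le_regWeight hα0.le hε)
    (hu k (le_of_max_le_right hk)) hu₀ (hv k) (hgv k) hΦ hgΦ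
  have h2 := integral_regWeight_sub_le hα0.le hΩ hε φ
  have h3 := hn k (le_of_max_le_left hk)
  have h4 : ‖gradL Ω (weight α) Φ - gradL Ω (weight α) u₀‖ ≤ δ / 2 := by
    rw [← gradL_sub]
    exact (norm_gradL_le _).trans hlt.le
  have h5 := pow_le_pow_left₀ (norm_nonneg _) h4 2
  rw [Real.dist_eq, sub_zero, abs_norm, gradL_sub]
  refine lt_of_pow_lt_pow_left₀ 2 hδ.le ?_
  linarith [sq_pos_of_pos hδ, div_pow δ 2 2]

end DegenerateElliptic

end

theorem lemma08p15 (N : ℕ) (hN : 2 ≤ N) (α : ℝ) (hα0 : 0 < α) (hα2 : α < 2)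
    (Ω : TopologicalSpace.Opens (EuclideanSpace ℝ (Fin N)))
    (hΩ : Bornology.IsBounded (Ω : Set (EuclideanSpace ℝ (Fin N))))
    (h0 : (0 : EuclideanSpace ℝ (Fin N)) ∈ Ω)
    (f : EuclideanSpace ℝ (Fin N) → ℝ)
    (hf : MemLp f 2 (DegenerateElliptic.weightedMeasure Ω
      (fun x => (DegenerateElliptic.weight α x)⁻¹)))
    (u : ∀ k : ℕ, DegenerateElliptic.H10 Ω (DegenerateElliptic.regWeight α (1 / (k : ℝ))))
    (hu : ∀ k : ℕ, 1 ≤ k → DegenerateElliptic.IsWeakSolution f (u k)) :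
    ∃ u₀ : DegenerateElliptic.H10 Ω (DegenerateElliptic.weight α),
      -- each `u k` belongs to `H¹_{w,0}(Ω)` and the sequence converges weakly there
      (∃ v : ℕ → DegenerateElliptic.H10 Ω (DegenerateElliptic.weight α),
        (∀ k : ℕ, 1 ≤ k →
          DegenerateElliptic.fn (v k) =ᵐ[volume.restrict (Ω : Set (EuclideanSpace ℝ (Fin N)))] DegenerateElliptic.fn (u k)) ∧
        DegenerateElliptic.WeaklyConverges v u₀) ∧
      -- strong convergence in the unweighted `L²(Ω)`
      Tendsto (fun k : ℕ => eLpNorm (DegenerateElliptic.fn (u k) - DegenerateElliptic.fn u₀) 2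
        (volume.restrict (Ω : Set (EuclideanSpace ℝ (Fin N))))) atTop (𝓝 0) ∧
      -- `u₀` is the unique weak solution of the degenerate problem
      DegenerateElliptic.IsWeakSolution f u₀ ∧
      ∀ v : DegenerateElliptic.H10 Ω (DegenerateElliptic.weight α),
        DegenerateElliptic.IsWeakSolution f v → v = u₀ := by
  have hN0 : 0 < N := by omega
  have hN2 : (2 : ℝ) ≤ N := by exact_mod_cast hN
  have hαN : α < N := hα2.trans_le hN2
  obtain ⟨R, hR0, hR⟩ := hΩ.exists_pos_norm_le
  have hw : DegenerateElliptic.IsAdmissible Ω α (R ^ α) (DegenerateElliptic.weight α) :=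
    DegenerateElliptic.isAdmissible_weight hα0.le hR
  obtain ⟨u₀, hu₀⟩ := DegenerateElliptic.exists_isWeakSolution hN0 hα0.le hα2.le hαN hΩ hw hf
  -- `k = 0` is harmless: `1 / 0 = 0` in Lean and `regWeight α 0` is `|x|^α`, so `v` is defined for
  -- all `k`.
  have hε : ∀ k : ℕ, (0 : ℝ) ≤ 1 / (k : ℝ) := fun k => by positivity
  choose v hv hgv using fun k => DegenerateElliptic.exists_H10_of_weight_le hN0 hα0.le hα2.le hαN
    hΩ hw (DegenerateElliptic.isAdmissible_regWeight hα0.le (hε k) hR)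
    (DegenerateElliptic.weight_le_regWeight hα0.le (hε k)) (u k)
  have hlim := DegenerateElliptic.tendsto_norm_gradL_sub hN0 hα0 hα2.le hαN hΩ hu hv hgv hu₀
  refine ⟨u₀, ⟨v, fun k _ => hv k, ?_⟩, ?_, hu₀, fun v' hv' =>
    hv'.unique hN0 hα0.le hα2.le hαN hΩ hw hu₀⟩
  · obtain ⟨K, hK, hb⟩ :=
      DegenerateElliptic.exists_norm_le_gradL hN0 hα0.le hα2.le hαN hΩ hw
    -- Coercivity upgrades energy convergence to norm convergence, which is stronger than the weak
    -- convergence required.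
    have hstrong : Tendsto v atTop (𝓝 u₀) := by
      rw [tendsto_iff_norm_sub_tendsto_zero]
      refine squeeze_zero (fun _ => norm_nonneg _) (fun k => hb (v k - u₀)) ?_
      simpa using hlim.const_mul K
    exact fun ℓ => (ℓ.continuous.tendsto u₀).comp hstrong
  -- The Poincaré inequality for `v k - u₀`, whose left side is the unweighted norm.
  · have hbound : ∀ k, eLpNorm (DegenerateElliptic.fn (u k) - DegenerateElliptic.fn u₀) 2
        (volume.restrict (Ω : Set (EuclideanSpace ℝ (Fin N)))) ≤
        ENNReal.ofReal (DegenerateElliptic.poincareConst α R) *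
          ENNReal.ofReal ‖DegenerateElliptic.gradL Ω (DegenerateElliptic.weight α) (v k - u₀)‖ := by
      intro k
      rw [ofReal_norm]
      refine le_of_eq_of_le (eLpNorm_congr_ae ?_) (DegenerateElliptic.eLpNorm_fn_le hN0 hα0.le
        hα2.le hαN hΩ hR0.le hR hw (v k - u₀))
      have hsub := DegenerateElliptic.ae_restrict_of_ae_weightedMeasure hN0 hw
        (Lp.coeFn_sub (v k).1.1.fst u₀.1.1.fst)
      exact ((hv k).symm.sub ae_eq_rfl).trans (EventuallyEq.symm hsub)
    refine tendsto_of_tendsto_of_tendsto_of_le_of_le tendsto_const_nhds ?_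
      (fun _ => zero_le) hbound
    have h1 := ENNReal.Tendsto.const_mul (a := ENNReal.ofReal (DegenerateElliptic.poincareConst α R))
      (ENNReal.tendsto_ofReal hlim) (Or.inr ENNReal.ofReal_ne_top)
    simpa using h1
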